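/- **Model.** A firm has $m>0$ units of a divisible resource. Requests arrive one by one; request $t$ has a size $s_t>0$ and a type $z_t\in\{\ell,h\}$, and must irrevocably be given an amount $a_t\in[0,s_t]$, with reward $a_t r_{z_t}$, where $0<r_\ell<r_h$; at most $m$ units are given out in total. An online algorithm (deterministic, or randomized, i.e. a random deterministic one) chooses $a_t$ from the requests seen up to time $t$ only. For a finite arrival sequence $I$ with total low- and high-reward demands $\ell(I),h(I)$ let $\mathrm{OPT}(I)=\min\{h(I),m\}r_h+\min\{\ell(I),(m-h(I))^+\}r_\ell$. Let $\mathcal R\subset\mathbb R_{\ge0}^2$ be nonempty and convex with $\bar x=\sup_{(x,y)\in\mathcal R}x<\infty$, and let $\underline x=\inf_{(x,y)\in\mathcal R}x$ and $M=\max\{m,\bar x\}$. For an algorithm $\mathcal A$ let $\textsc{consis}(\mathcal A)$ be the infimum of $\mathbb E[\mathrm{Rew}(\mathcal A,I)]/\mathrm{OPT}(I)$ over all $I$ with $(\ell(I),h(I))\in\mathcal R$, and $\textsc{robust}(\mathcal A)$ the infimum over all $I$ ($0/0$ is read as $1$). Let $C^\star(\mathcal R)=\sup_{\mathcal A}\textsc{consis}(\mathcal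 A)$. **Protection levels.** A protection level (PL) function on an interval is a function $p\ge0$ that is non-increasing with slope at least $-1$, i.e. $0\le p(x)-p(x')\le x'-x$ for $x\le x'$; a PL function on $[0,M]$ is continued by $p(x)=p(M)$ for $x\ge M$. The protection-level algorithm (PLA) with PL function $p$ gives a high-reward request of size $s$ the amount $\min\{s,\hat m\}$, and a low-reward request of size $s$ the amount $\min\{\hat m,\min\{\max\{m-p(\bar s+s)-\bar a,0\},s\}\}$, where $\hat m$ is the remaining resource, $\bar s$ the low-reward demand received before, and $\bar a$ the amount given to it. Put $$\mathrm{CP}_o(p;(x,y))=\frac{\min\{y,m\}r_h+\min\{x,(m-p)^+\}r_\ell}{\min\{y,m\}r_h+\min\{x,(m-y)^+\}r_\ell},\qquad \mathrm{CP}_u(p;(x,y))=\frac{\max\{p,\min\{y,(m-x)^+\}\}r_h+\min\{x,m-p\}r_\ell}{\min\{y,m\}r_h+\min\{x,(m-y)^+\}r_\ell}$$ ($0/0$ is read as $1$). **Bounds.** Let $X$ be the projection of $\mathcal R$ to the $x$-axis, and for $x\in X$ let $\underline{\mathcal H}(x)$ and $\overline{\mathcal H}(x)$ be the infimum and supremum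 of $\min\{y,m\}$ over $(x,y)\in\mathcal R$. For $x\in X$ let $u_0(x)=\sup\{p\in[0,m]:\mathrm{CP}_o(p;(x,\underline{\mathcal H}(x)))\ge C\}$ and $l_0(x)=\inf\{p\in[0,m]:\mathrm{CP}_u(p;(x,\overline{\mathcal H}(x)))\ge C\}$. For $x\in[0,\bar x]$ let $$u(x;C)=\inf\big(\{m\}\cup\{u_0(t):t\in X,\ t\le x\}\big),\quad l(x;C)=\sup\big(\{0\}\cup\{l_0(t):t\in X,\ t\ge x\}\big),\quad \widetilde l(x;C)=\sup_{0\le t\le x}\big(l(t;C)-(x-t)\big)^+ .$$ Let $\rho=\frac1{2-r_\ell/r_h}$, $\underline g(R)=\frac{m(R-r_\ell/r_h)}{1-r_\ell/r_h}$ and $\bar g(x;R)=m-R\min\{x,m\}$. **Problems.** In each of them $R\in[0,\rho]$ is maximized over pairs $(R,p)$. * (C-Pareto-Trans): $p$ is a PL function on $[0,M]$ with $\widetilde l(x;C)\le p(x)\le u(x;C)$ on $[0,\bar x]$ and $\underline g(R)\le p(x)\le\bar g(x;R)$ on $[0,M]$. * (Right): $p$ is a PL function on $[\bar x,M]$ with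 $\widetilde l(\bar x;C)\le p(\bar x)\le u(\bar x;C)$ and $\underline g(R)\le p(x)\le\bar g(x;R)$ on $[\bar x,M]$. * (Left), given a solution $p_{\text{right}}$ of (Right): $p$ is a PL function on $[0,\bar x]$ with $\widetilde l(x;C)\le p(x)\le u(x;C)$ on $[\underline x,\bar x]$, $\underline g(R)\le p(x)\le\bar g(x;R)$ on $[0,\bar x]$, and $p(\bar x)=p_{\text{right}}(\bar x)$. **Theorem.** Let $0\le C\le C^\star(\mathcal R)$. (a) Let $\bar p$ be the point of $[\widetilde l(\bar x;C),u(\bar x;C)]$ closest to $\underline g(\rho)$, let $\bar R=\min\{\mathrm{CP}_o(\bar p;(\bar x,0)),\mathrm{CP}_u(\bar p;(M,m))\}$, and let $p_{\text{right}}(\bar x)=\bar p$ and, for $x\in(\bar x,M]$, $p_{\text{right}}(x)=\underline g(\bar R)$ if $\bar p<\underline g(\rho)$, $p_{\text{right}}(x)=\bar g(x;\bar R)$ if $\bar p>\bar g(\bar x;\rho)$, and $p_{\text{right}}(x)=\max\{-x+\bar x+\bar p,\underline g(\rho)\}$ otherwise. Let $p_{\text{left}}(x)=\max\{\widetilde l(x;C),\bar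 p\}$ on $[0,\bar x]$. Then $p_{\text{right}}$ is optimal for (Right), with value $R_{\text{right}}=\min\{\mathrm{CP}_o(p_{\text{right}}(\bar x);(\bar x,0)),\mathrm{CP}_u(p_{\text{right}}(M);(M,m))\}$, the function $p_{\text{left}}$ is optimal for (Left) for this $p_{\text{right}}$, with some value $R_{\text{left}}$, and $\min\{R_{\text{right}},R_{\text{left}}\}=\min\{R_{\text{right}},\inf_{x\in[0,\bar x]}\mathrm{CP}_o(p_{\text{left}}(x);(x,0))\}$. (b) Let $p_{\text{right}}$ be any optimal solution of (Right), with value $R_{\text{right}}$, and $p_{\text{left}}$ any optimal solution of (Left) for this $p_{\text{right}}$, with value $R_{\text{left}}$. Then the function $p^\star$ that is $p_{\text{left}}$ on $[0,\bar x]$ and $p_{\text{right}}$ on $[\bar x,M]$ is an optimal solution of (C-Pareto-Trans), and the optimal value of that problem is $R^\star=\min\{R_{\text{right}},R_{\text{left}}\}$. (c) For $p^\star$ as in (b), the PLA with PL function $p^\star$ has consistent ratio at least $C$ and robust ratio $R^\star$, and every deterministic or randomized online algorithm with consistent ratio at least $C$ has robust ratio at most $R^\star$. -/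

import Mathlib

open MeasureTheory

noncomputable section

namespace RobustAlloc

/-! ## The model: requests, online algorithms, performance measures -/

/-- The data of the market: `m` units of a divisible resource, and per-unit rewards
`rl < rh` of low-reward and high-reward requests. -/
structure Market where
  m : ℝ
  rl : ℝ
  rh : ℝ
  m_pos : 0 < m
  rl_pos : 0 < rl
  rl_lt_rh : rl < rh

/-- The two types of requests. -/
inductive Kind where
  | low : Kind
  | high : Kind

/-- A request has a positive size and a type. -/
structure Request where
  size : ℝ
  kind : Kind
  size_pos : 0 < size

/-- The size of a request if it is a low-reward request, and `0` otherwise. -/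
def Request.lowSize (q : Request) : ℝ :=
  match q.kind with
  | Kind.low => q.size
  | Kind.high => 0

/-- The size of a request if it is a high-reward request, and `0` otherwise. -/
def Request.highSize (q : Request) : ℝ :=
  match q.kind with
  | Kind.low => 0
  | Kind.high => q.size

/-- Total low-reward demand of an arrival sequence. -/
def lowDemand (I : List Request) : ℝ := (I.map Request.lowSize).sum

/-- Total high-reward demand of an arrival sequence. -/
def highDemand (I : List Request) : ℝ := (I.map Request.highSize).sum

/-- Reward per unit of a request of the given type. -/
def Market.rate (M : Market) : Kind → ℝ
  | Kind.low => M.rl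
  | Kind.high => M.rh

/-- Total weighted amount given out along `I` by the allocation rule `alloc`, where
`alloc past q` is the amount given to the request `q` that arrives after `past`. -/
def weightedTotal (w : Kind → ℝ) (alloc : List Request → Request → ℝ) (I : List Request) : ℝ :=
  ∑ t : Fin I.length, w (I.get t).kind * alloc (I.take t) (I.get t)

/-- A deterministic online algorithm: the amount given to the current request depends only on
the requests seen so far and on the current one, it is between `0` and the size of the current
request, and no more than `m` units are given out in total. -/
structure DetAlg (M : Market) where
  alloc : List Request → Request → ℝ
  alloc_nonneg : ∀ past q, 0 ≤ alloc past q
  alloc_le : ∀ past q, alloc past q ≤ q.size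
  capacity : ∀ I, weightedTotal (fun _ => 1) alloc I ≤ M.m

/-- Reward collected by a deterministic algorithm along an arrival sequence. -/
def DetAlg.reward {M : Market} (A : DetAlg M) (I : List Request) : ℝ :=
  weightedTotal M.rate A.alloc I

/-- A (possibly randomized) online algorithm: a random deterministic online algorithm. -/
structure OnlineAlg (M : Market) where
  Ω : Type
  mΩ : MeasurableSpace Ω
  μ : Measure Ω
  prob : IsProbabilityMeasure μ
  alg : Ω → DetAlg M
  meas : ∀ past q, Measurable (fun ω => (alg ω).alloc past q)

/-- A deterministic algorithm as an online algorithm. -/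
def DetAlg.toOnline {M : Market} (A : DetAlg M) : OnlineAlg M where
  Ω := Unit
  mΩ := inferInstance
  μ := Measure.dirac ()
  prob := inferInstance
  alg := fun _ => A
  meas := fun _ _ => measurable_const

/-- Expected reward of an online algorithm along an arrival sequence. -/
def OnlineAlg.reward {M : Market} (A : OnlineAlg M) (I : List Request) : ℝ :=
  ∫ ω, (A.alg ω).reward I ∂A.μ

/-- Optimal clairvoyant reward for total demands `x` (low) and `y` (high): high-reward requests
are served first, and what is left is given to low-reward requests. -/
def Market.opt (M : Market) (x y : ℝ) : ℝ :=
  min y M.m * M.rh + min x (max (M.m - y) 0) * M.rl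

/-- The ratio of a reward `r` to the clairvoyant reward for the demands `(x, y)`.
It is read as `1` when there is no demand at all. -/
def Market.ratio (M : Market) (r x y : ℝ) : ℝ :=
  if M.opt x y = 0 then 1 else r / M.opt x y

/-- Expected reward of an algorithm relative to the clairvoyant reward on one sequence. -/
def OnlineAlg.perf {M : Market} (A : OnlineAlg M) (I : List Request) : ℝ :=
  M.ratio (A.reward I) (lowDemand I) (highDemand I)

/-- The arrival sequences that are consistent with the region `R` of demand vectors. -/
def consistentSeqs (R : Set (ℝ × ℝ)) : Set (List Request) :=
  {I | (lowDemand I, highDemand I) ∈ R}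

/-- Consistent ratio: the worst case over the sequences consistent with `R`. -/
def OnlineAlg.consis {M : Market} (A : OnlineAlg M) (R : Set (ℝ × ℝ)) : ℝ :=
  sInf (A.perf '' consistentSeqs R)

/-- Robust ratio: the worst case over all sequences. -/
def OnlineAlg.robust {M : Market} (A : OnlineAlg M) : ℝ :=
  sInf (Set.range A.perf)

/-- The maximum consistent ratio of an online algorithm for the region `R`. -/
def Market.Cstar (M : Market) (R : Set (ℝ × ℝ)) : ℝ :=
  sSup (Set.range (fun A : OnlineAlg M => A.consis R))

/-! ## Protection level algorithms -/

/-- What a protection level algorithm remembers: the low-reward demand seen so far, the amount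
given to low-reward requests so far, and the total amount given out so far. -/
structure PLAState where
  lowSeen : ℝ
  lowGiven : ℝ
  used : ℝ

/-- The amount that the protection level algorithm with protection level function `p` gives to
the request `q` in the state `st`. -/
def Market.plaGive (M : Market) (p : ℝ → ℝ) (st : PLAState) (q : Request) : ℝ :=
  match q.kind with
  | Kind.high => min q.size (M.m - st.used)
  | Kind.low =>
      min (M.m - st.used)
        (min (max (M.m - p (st.lowSeen + q.size) - st.lowGiven) 0) q.size)

/-- The state after the request `q`. -/
def Market.plaStep (M : Market) (p : ℝ → ℝ) (st : PLAState) (q : Request) : PLAState :=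
  match q.kind with
  | Kind.high => ⟨st.lowSeen, st.lowGiven, st.used + M.plaGive p st q⟩
  | Kind.low =>
      ⟨st.lowSeen + q.size, st.lowGiven + M.plaGive p st q, st.used + M.plaGive p st q⟩

/-- The state after a sequence of requests. -/
def Market.plaState (M : Market) (p : ℝ → ℝ) (past : List Request) : PLAState :=
  past.foldl (M.plaStep p) ⟨0, 0, 0⟩

lemma weightedTotal_append (w : Kind → ℝ) (alloc : List Request → Request → ℝ)
    (I : List Request) (q : Request) :
    weightedTotal w alloc (I ++ [q]) = weightedTotal w alloc I + w q.kind * alloc I q := by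
  have h : ∀ J : List Request, weightedTotal w alloc J =
      ∑ t ∈ Finset.range J.length,
        (if ht : t < J.length then w (J[t]).kind * alloc (J.take t) (J[t]) else 0) := by
    intro J
    rw [Finset.sum_range]
    exact Finset.sum_congr rfl (fun t _ => by simp [t.2])
  rw [h, h, show Finset.range (I ++ [q]).length = Finset.range (I.length + 1) by simp,
    Finset.sum_range_succ]
  congr 1
  · refine Finset.sum_congr rfl (fun t ht => ?_)
    have ht' : t < I.length := Finset.mem_range.mp ht
    have h1 : t < (I ++ [q]).length := by simp; omega
    rw [dif_pos h1, dif_pos ht', List.getElem_append_left ht',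
      List.take_append_of_le_length ht'.le]
  · simp

lemma Market.plaState_append (M : Market) (p : ℝ → ℝ) (I : List Request) (q : Request) :
    M.plaState p (I ++ [q]) = M.plaStep p (M.plaState p I) q := by
  simp [Market.plaState, List.foldl_append]

lemma Market.plaStep_used (M : Market) (p : ℝ → ℝ) (st : PLAState) (q : Request) :
    (M.plaStep p st q).used = st.used + M.plaGive p st q := by
  unfold Market.plaStep
  split <;> rfl

lemma Market.plaGive_le_rest (M : Market) (p : ℝ → ℝ) (st : PLAState) (q : Request) :
    M.plaGive p st q ≤ M.m - st.used := by
  unfold Market.plaGive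
  split
  · exact min_le_right _ _
  · exact min_le_left _ _

lemma Market.plaState_used_le (M : Market) (p : ℝ → ℝ) (I : List Request) :
    (M.plaState p I).used ≤ M.m := by
  induction I using List.reverseRecOn with
  | nil => exact M.m_pos.le
  | append_singleton I q _ =>
    rw [M.plaState_append, M.plaStep_used]
    linarith [M.plaGive_le_rest p (M.plaState p I) q]

/-- The protection level algorithm with protection level function `p`. -/
def Market.pla (M : Market) (p : ℝ → ℝ) : DetAlg M where
  alloc := fun past q => M.plaGive p (M.plaState p past) q
  alloc_nonneg := by
    intro past q
    have h := M.plaState_used_le p past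
    have hq := q.size_pos
    unfold Market.plaGive
    split
    · exact le_min hq.le (by linarith)
    · exact le_min (by linarith) (le_min (le_max_right _ _) hq.le)
  alloc_le := by
    intro past q
    unfold Market.plaGive
    split
    · exact min_le_left _ _
    · exact (min_le_right _ _).trans (min_le_right _ _)
  capacity := by
    intro I
    have h : weightedTotal (fun _ => 1) (fun past q => M.plaGive p (M.plaState p past) q) I
        = (M.plaState p I).used := by
      induction I using List.reverseRecOn with
      | nil => simp [weightedTotal, Market.plaState]
      | append_singleton I q ih =>
        rw [weightedTotal_append, ih, M.plaState_append, M.plaStep_used, one_mul]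
    rw [h]
    exact M.plaState_used_le p I

/-! ## Compatible ratios -/

/-- Compatible ratio of the point `(x, y)` in the over-protected case `min y m ≤ p`. -/
def Market.CPo (M : Market) (p x y : ℝ) : ℝ :=
  M.ratio (min y M.m * M.rh + min x (max (M.m - p) 0) * M.rl) x y

/-- Compatible ratio of the point `(x, y)` in the under-protected case `p < min y m`. -/
def Market.CPu (M : Market) (p x y : ℝ) : ℝ :=
  M.ratio (max p (min y (max (M.m - x) 0)) * M.rh + min x (M.m - p) * M.rl) x y

/-! ## The region and the consistency bounds -/

/-- The low-reward demands that occur in the region. -/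
def proj (R : Set (ℝ × ℝ)) : Set ℝ := Prod.fst '' R

/-- Smallest low-reward demand. -/
def xmin (R : Set (ℝ × ℝ)) : ℝ := sInf (proj R)

/-- Largest low-reward demand. -/
def xmax (R : Set (ℝ × ℝ)) : ℝ := sSup (proj R)

/-- Lower envelope of the region, capped at `m`. (All compatible ratios depend on `y` only
through `min y m`.) -/
def Market.lowEnv (M : Market) (R : Set (ℝ × ℝ)) (x : ℝ) : ℝ :=
  sInf {h | ∃ y, (x, y) ∈ R ∧ h = min y M.m}

/-- Upper envelope of the region, capped at `m`. -/
def Market.upEnv (M : Market) (R : Set (ℝ × ℝ)) (x : ℝ) : ℝ :=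
  sSup {h | ∃ y, (x, y) ∈ R ∧ h = min y M.m}

/-- The largest protection level in `[0, m]` whose compatible ratio at the lowest point of the
region above `x` is at least `C`. -/
def Market.uPt (M : Market) (R : Set (ℝ × ℝ)) (C x : ℝ) : ℝ :=
  sSup {p | p ∈ Set.Icc 0 M.m ∧ C ≤ M.CPo p x (M.lowEnv R x)}

/-- The smallest protection level in `[0, m]` whose compatible ratio at the highest point of the
region above `x` is at least `C`. -/
def Market.lPt (M : Market) (R : Set (ℝ × ℝ)) (C x : ℝ) : ℝ :=
  sInf {p | p ∈ Set.Icc 0 M.m ∧ C ≤ M.CPu p x (M.upEnv R x)}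

/-- Upper bound function `u(x; C)`: the largest non-increasing function with values in `[0, m]`
below the pointwise bounds; it is `m` to the left of the region. -/
def Market.u (M : Market) (R : Set (ℝ × ℝ)) (C x : ℝ) : ℝ :=
  sInf ({M.m} ∪ M.uPt R C '' (proj R ∩ Set.Iic x))

/-- Lower bound function `l(x; C)`: the smallest non-increasing function with values in `[0, m]`
above the pointwise bounds; it is constant to the left of the region. -/
def Market.l (M : Market) (R : Set (ℝ × ℝ)) (C x : ℝ) : ℝ :=
  sSup ({0} ∪ M.lPt R C '' (proj R ∩ Set.Ici x))

/-- The lower bound `l̃(x; C)`: the smallest non-negative function above `l` on `[0, ∞)` that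
nowhere decreases faster than with slope `-1`. Where `l` is steeper than that, it is replaced by
the positive part of the line of slope `-1`. -/
def Market.lTilde (M : Market) (R : Set (ℝ × ℝ)) (C x : ℝ) : ℝ :=
  sSup ((fun t => max (M.l R C t - (x - t)) 0) '' Set.Icc 0 x)

/-! ## The robustness bounds -/

/-- `ρ = 1 / (2 - rl / rh)`. -/
def Market.rho (M : Market) : ℝ := 1 / (2 - M.rl / M.rh)

/-- Lower bound for the protection level at robust ratio `r`; it does not depend on `x`. -/
def Market.gLow (M : Market) (r : ℝ) : ℝ := M.m * (r - M.rl / M.rh) / (1 - M.rl / M.rh)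

/-- Upper bound for the protection level at robust ratio `r`; it is constant beyond `m`. -/
def Market.gUp (M : Market) (r x : ℝ) : ℝ := -r * min x M.m + M.m

/-! ## The optimization problems -/

/-- Validity of a protection level function on `[a, b]`: it is non-negative, non-increasing and
its slope is at least `-1` (so it is continuous). -/
def ValidOn (p : ℝ → ℝ) (a b : ℝ) : Prop :=
  (∀ x ∈ Set.Icc a b, 0 ≤ p x) ∧
  ∀ x ∈ Set.Icc a b, ∀ y ∈ Set.Icc a b, x ≤ y → p y ≤ p x ∧ p x - (y - x) ≤ p y

/-- `max {m, x̄}`, the right end of the domain of protection level functions. -/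
def Market.xend (M : Market) (R : Set (ℝ × ℝ)) : ℝ := max M.m (xmax R)

/-- Feasibility for the transformed problem. -/
def Market.TransFeasible (M : Market) (R : Set (ℝ × ℝ)) (C r : ℝ) (p : ℝ → ℝ) : Prop :=
  r ∈ Set.Icc 0 M.rho ∧
  (∀ x ∈ Set.Icc 0 (xmax R), M.lTilde R C x ≤ p x ∧ p x ≤ M.u R C x) ∧
  (∀ x ∈ Set.Icc 0 (M.xend R), M.gLow r ≤ p x ∧ p x ≤ M.gUp r x) ∧
  ValidOn p 0 (M.xend R)

/-- Feasibility for the right problem. -/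
def Market.RightFeasible (M : Market) (R : Set (ℝ × ℝ)) (C r : ℝ) (p : ℝ → ℝ) : Prop :=
  r ∈ Set.Icc 0 M.rho ∧
  (M.lTilde R C (xmax R) ≤ p (xmax R) ∧ p (xmax R) ≤ M.u R C (xmax R)) ∧
  (∀ x ∈ Set.Icc (xmax R) (M.xend R), M.gLow r ≤ p x ∧ p x ≤ M.gUp r x) ∧
  ValidOn p (xmax R) (M.xend R)

/-- Feasibility for the left problem with prescribed value `v` at `x̄`. -/
def Market.LeftFeasible (M : Market) (R : Set (ℝ × ℝ)) (C v r : ℝ) (p : ℝ → ℝ) : Prop :=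
  r ∈ Set.Icc 0 M.rho ∧
  (∀ x ∈ Set.Icc (xmin R) (xmax R), M.lTilde R C x ≤ p x ∧ p x ≤ M.u R C x) ∧
  (∀ x ∈ Set.Icc 0 (xmax R), M.gLow r ≤ p x ∧ p x ≤ M.gUp r x) ∧
  ValidOn p 0 (xmax R) ∧
  p (xmax R) = v

/-- `(r, p)` is an optimal solution of the problem of maximizing `r` over the feasible pairs;
in particular `r` is the optimal objective value. -/
def IsOptimal (Feas : ℝ → (ℝ → ℝ) → Prop) (r : ℝ) (p : ℝ → ℝ) : Prop :=
  Feas r p ∧ ∀ r' p', Feas r' p' → r' ≤ r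

/-- The function that is `pl` on `[0, x̄]` and `pr` on `[x̄, max {m, x̄}]`, continued by a
constant beyond `max {m, x̄}`. -/
def Market.glue (M : Market) (R : Set (ℝ × ℝ)) (pl pr : ℝ → ℝ) (x : ℝ) : ℝ :=
  if x ≤ xmax R then pl x else pr (min x (M.xend R))

/-! ## The explicit solutions -/

/-- The point of `[l̃(x̄; C), u(x̄; C)]` closest to `gLow ρ`. -/
def Market.pBar (M : Market) (R : Set (ℝ × ℝ)) (C : ℝ) : ℝ :=
  max (M.lTilde R C (xmax R)) (min (M.u R C (xmax R)) (M.gLow M.rho))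

/-- The ratio that is determined by the protection level `pBar`. -/
def Market.rBar (M : Market) (R : Set (ℝ × ℝ)) (C : ℝ) : ℝ :=
  min (M.CPo (M.pBar R C) (xmax R) 0) (M.CPu (M.pBar R C) (M.xend R) M.m)

/-- The explicit solution of the right problem. -/
def Market.pRight (M : Market) (R : Set (ℝ × ℝ)) (C x : ℝ) : ℝ :=
  if x ≤ xmax R then M.pBar R C
  else if M.pBar R C < M.gLow M.rho then M.gLow (M.rBar R C)
  else if M.gUp M.rho (xmax R) < M.pBar R C then M.gUp (M.rBar R C) x
  else max (-x + xmax R + M.pBar R C) (M.gLow M.rho)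

/-- The explicit solution of the left problem. -/
def Market.pLeft (M : Market) (R : Set (ℝ × ℝ)) (C x : ℝ) : ℝ :=
  max (M.lTilde R C x) (M.pBar R C)

/-- The explicit value of the right problem. -/
def Market.rRight (M : Market) (R : Set (ℝ × ℝ)) (C : ℝ) : ℝ :=
  min (M.CPo (M.pRight R C (xmax R)) (xmax R) 0)
    (M.CPu (M.pRight R C (M.xend R)) (M.xend R) M.m)

/-- The explicit value of the transformed problem. -/
def Market.rStar (M : Market) (R : Set (ℝ × ℝ)) (C : ℝ) : ℝ :=
  min (M.rRight R C)
    (sInf ((fun x => M.CPo (M.pLeft R C x) x 0) '' Set.Icc 0 (xmax R)))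

end RobustAlloc

end

open RobustAlloc

open RobustAlloc

namespace RobustAlloc

/-! ### The clairvoyant reward -/

/-! Feed an online algorithm low-reward requests of total size `x`, then one high-reward request. If
`g` is the expected amount given to the low-reward part, then `m - g` acts as a protection level:
capacity bounds the expected reward by that of a level `m - g`, so a guaranteed ratio constrains
this level (`Market.Compat`). With the low-reward demand split as `s`, then `t - s`, the levels at
`s` and `t` are ordered and differ by at most `t - s` (`OnlineAlg.exists_levels`); the same pair
serves the consistency and the robustness guarantee.

Such pairs suffice for the upper bound. They show that the lower bounds `lTilde` and `gLow r` lie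
below the upper bounds `u` and `gUp r`, where `r` is the robust ratio. The least candidate, the
maximum of `lTilde` and `gLow r`, is then feasible at `r` (`OnlineAlg.exists_transFeasible`). For
`C` up to a possibly unattained supremum, a compactness argument still gives `lTilde ≤ u`.

Conversely, a protection level algorithm either serves all high-reward demand, with its low-reward
amount known exactly, or exhausts the resource (`Market.pla_invariant`). The upper bounds on `p`
handle the first case and the lower bounds the second (`le_pla_robust`, `le_pla_consis`). Feasible
pairs thus yield algorithms, and algorithms yield feasible pairs.

The transformed problem splits at `xmax R`: an optimal right value `v` satisfies the robustness
bounds for every smaller ratio, and the maximum of `lTilde` and `v` is then the least left candidate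
(`glue_isOptimal`). The explicit solutions follow because `gLow` and `gUp` invert the compatible
ratios at `(x, m)` and `(x, 0)`, and meet at ratio `ρ` once `x ≥ m`. -/

lemma Market.rh_pos (M : Market) : 0 < M.rh := M.rl_pos.trans M.rl_lt_rh

lemma Market.opt_nonneg (M : Market) {x y : ℝ} (hx : 0 ≤ x) (hy : 0 ≤ y) : 0 ≤ M.opt x y := by
  have := M.rl_pos.le
  have := M.rh_pos.le
  have : 0 ≤ min y M.m := le_min hy M.m_pos.le
  have : 0 ≤ min x (max (M.m - y) 0) := le_min hx (le_max_right _ _)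
  unfold Market.opt
  positivity

lemma Market.opt_min (M : Market) (x y : ℝ) : M.opt x (min y M.m) = M.opt x y := by
  have h : max (M.m - min y M.m) 0 = max (M.m - y) 0 := by
    rcases le_total y M.m with h | h
    · rw [min_eq_left h]
    · rw [min_eq_right h, sub_self, max_self, max_eq_right (by linarith)]
  unfold Market.opt
  rw [h, min_eq_left (min_le_right y M.m)]

/-- Additional high-reward demand displaces at most an equal amount of low-reward demand, which is
worth less per unit. -/
lemma Market.opt_mono (M : Market) (x : ℝ) {y y' : ℝ} (h : y ≤ y') :
    M.opt x y ≤ M.opt x y' := by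
  have h1 : min x (max (M.m - y) 0) - min x (max (M.m - y') 0) ≤ min y' M.m - min y M.m := by
    simp only [min_def, max_def]
    split_ifs <;> linarith
  have h2 : min y M.m ≤ min y' M.m := min_le_min_right _ h
  have h3 : min x (max (M.m - y') 0) ≤ min x (max (M.m - y) 0) :=
    min_le_min_left _ (max_le_max_right _ (by linarith))
  have := M.rl_lt_rh
  have := M.rl_pos
  unfold Market.opt
  nlinarith

lemma Market.opt_top (M : Market) {x : ℝ} (hx : 0 ≤ x) : M.opt x M.m = M.m * M.rh := by
  simp [Market.opt, hx]

lemma Market.opt_le (M : Market) {x : ℝ} (hx : 0 ≤ x) (y : ℝ) : M.opt x y ≤ M.m * M.rh := by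
  rw [← M.opt_min, ← M.opt_top hx]
  exact M.opt_mono x (min_le_right _ _)

lemma Market.opt_zero (M : Market) (x : ℝ) : M.opt x 0 = min x M.m * M.rl := by
  simp [Market.opt, M.m_pos.le]

lemma Market.continuous_opt (M : Market) (x : ℝ) : Continuous (M.opt x) := by
  unfold Market.opt
  fun_prop

/-- With its converse below, this replaces ratios by division-free inequalities. The convention for
zero demand is what requires `c ≤ 1` here and `0 ≤ r` there. -/
lemma Market.le_ratio (M : Market) {c r x y : ℝ} (hx : 0 ≤ x) (hy : 0 ≤ y) (hc : c ≤ 1)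
    (h : c * M.opt x y ≤ r) : c ≤ M.ratio r x y := by
  unfold Market.ratio
  split_ifs with h0
  · exact hc
  · exact (le_div_iff₀ (lt_of_le_of_ne (M.opt_nonneg hx hy) (Ne.symm h0))).2 h

lemma Market.mul_opt_le (M : Market) {c r x y : ℝ} (hx : 0 ≤ x) (hy : 0 ≤ y) (hr : 0 ≤ r)
    (h : c ≤ M.ratio r x y) : c * M.opt x y ≤ r := by
  unfold Market.ratio at h
  split_ifs at h with h0
  · rw [h0, mul_zero]
    exact hr
  · exact (le_div_iff₀ (lt_of_le_of_ne (M.opt_nonneg hx hy) (Ne.symm h0))).1 h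

/-! ### Demands and expected totals -/

lemma lowDemand_append (I J : List Request) :
    lowDemand (I ++ J) = lowDemand I + lowDemand J := by
  simp [lowDemand]

lemma highDemand_append (I J : List Request) :
    highDemand (I ++ J) = highDemand I + highDemand J := by
  simp [highDemand]

lemma lowDemand_nonneg (I : List Request) : 0 ≤ lowDemand I := by
  refine List.sum_nonneg fun a ha => ?_
  obtain ⟨q, -, rfl⟩ := List.mem_map.1 ha
  unfold Request.lowSize
  split
  exacts [q.size_pos.le, le_rfl]

lemma highDemand_nonneg (I : List Request) : 0 ≤ highDemand I := by
  refine List.sum_nonneg fun a ha => ?_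
  obtain ⟨q, -, rfl⟩ := List.mem_map.1 ha
  unfold Request.highSize
  split
  exacts [le_rfl, q.size_pos.le]

/-- The sequence that consists of one request of size `x`, or of none if `x ≤ 0`. -/
noncomputable def single (k : Kind) (x : ℝ) : List Request :=
  if h : 0 < x then [⟨x, k, h⟩] else []

lemma lowDemand_single_low {x : ℝ} (hx : 0 ≤ x) : lowDemand (single Kind.low x) = x := by
  unfold single
  split_ifs with h
  · simp [lowDemand, Request.lowSize]
  · simp [lowDemand, le_antisymm (not_lt.1 h) hx]

lemma lowDemand_single_high (x : ℝ) : lowDemand (single Kind.high x) = 0 := by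
  unfold single
  split_ifs <;> simp [lowDemand, Request.lowSize]

lemma highDemand_single_low (x : ℝ) : highDemand (single Kind.low x) = 0 := by
  unfold single
  split_ifs <;> simp [highDemand, Request.highSize]

lemma highDemand_single_high {x : ℝ} (hx : 0 ≤ x) : highDemand (single Kind.high x) = x := by
  unfold single
  split_ifs with h
  · simp [highDemand, Request.highSize]
  · simp [highDemand, le_antisymm (not_lt.1 h) hx]

attribute [instance] OnlineAlg.mΩ OnlineAlg.prob

lemma OnlineAlg.integrable_alloc {M : Market} (A : OnlineAlg M) (past : List Request)
    (q : Request) : Integrable (fun ω => (A.alg ω).alloc past q) A.μ := by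
  refine Integrable.of_bound (A.meas past q).aestronglyMeasurable q.size
    (Filter.Eventually.of_forall fun ω => ?_)
  rw [Real.norm_of_nonneg ((A.alg ω).alloc_nonneg past q)]
  exact (A.alg ω).alloc_le past q

lemma OnlineAlg.integrable_weightedTotal {M : Market} (A : OnlineAlg M) (w : Kind → ℝ)
    (I : List Request) : Integrable (fun ω => weightedTotal w (A.alg ω).alloc I) A.μ :=
  integrable_finsetSum _ fun _ _ => (A.integrable_alloc _ _).const_mul _

/-- Expected weighted amount given out along `I`. -/
noncomputable def OnlineAlg.total {M : Market} (A : OnlineAlg M) (w : Kind → ℝ)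
    (I : List Request) : ℝ :=
  ∫ ω, weightedTotal w (A.alg ω).alloc I ∂A.μ

lemma OnlineAlg.reward_eq_total {M : Market} (A : OnlineAlg M) (I : List Request) :
    A.reward I = A.total M.rate I := rfl

lemma OnlineAlg.total_nil {M : Market} (A : OnlineAlg M) (w : Kind → ℝ) : A.total w [] = 0 := by
  simp [OnlineAlg.total, weightedTotal]

lemma OnlineAlg.total_one_le {M : Market} (A : OnlineAlg M) (I : List Request) :
    A.total (fun _ => 1) I ≤ M.m := by
  have h := integral_mono (A.integrable_weightedTotal (fun _ => 1) I)
    (integrable_const M.m) (fun ω => (A.alg ω).capacity I)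
  simpa [OnlineAlg.total] using h

lemma OnlineAlg.reward_nonneg {M : Market} (A : OnlineAlg M) (I : List Request) :
    0 ≤ A.reward I := by
  refine integral_nonneg fun ω => ?_
  change 0 ≤ weightedTotal M.rate (A.alg ω).alloc I
  refine Finset.sum_nonneg fun t _ => mul_nonneg ?_ ((A.alg ω).alloc_nonneg _ _)
  unfold Market.rate
  split
  exacts [M.rl_pos.le, M.rh_pos.le]

/-- The witness `d` is the expected amount given to the last request. It is the same for all weights
`w`, which ties the reward to the capacity constraint. -/
lemma OnlineAlg.exists_total_append_single {M : Market} (A : OnlineAlg M) (I : List Request)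
    (k : Kind) {x : ℝ} (hx : 0 ≤ x) :
    ∃ d, 0 ≤ d ∧ d ≤ x ∧ ∀ w, A.total w (I ++ single k x) = A.total w I + w k * d := by
  unfold single
  split_ifs with h
  · set q : Request := ⟨x, k, h⟩
    refine ⟨∫ ω, (A.alg ω).alloc I q ∂A.μ,
      integral_nonneg fun ω => (A.alg ω).alloc_nonneg _ _, ?_, fun w => ?_⟩
    · have h := integral_mono (A.integrable_alloc I q)
        (integrable_const x) (fun ω => (A.alg ω).alloc_le I q)
      simpa using h
    · unfold OnlineAlg.total
      simp_rw [weightedTotal_append]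
      rw [integral_add (A.integrable_weightedTotal w I) ((A.integrable_alloc I q).const_mul _),
        integral_const_mul]
  · exact ⟨0, le_rfl, hx, fun w => by simp⟩

lemma OnlineAlg.perf_nonneg {M : Market} (A : OnlineAlg M) (I : List Request) : 0 ≤ A.perf I :=
  M.le_ratio (lowDemand_nonneg I) (highDemand_nonneg I) zero_le_one
    (by rw [zero_mul]; exact A.reward_nonneg I)

lemma OnlineAlg.consis_le_perf {M : Market} (A : OnlineAlg M) {R : Set (ℝ × ℝ)}
    {I : List Request} (hI : (lowDemand I, highDemand I) ∈ R) : A.consis R ≤ A.perf I :=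
  csInf_le ⟨0, by rintro _ ⟨J, -, rfl⟩; exact A.perf_nonneg J⟩ ⟨I, hI, rfl⟩

lemma OnlineAlg.robust_le_perf {M : Market} (A : OnlineAlg M) (I : List Request) :
    A.robust ≤ A.perf I :=
  csInf_le ⟨0, by rintro _ ⟨J, rfl⟩; exact A.perf_nonneg J⟩ ⟨I, rfl⟩

lemma OnlineAlg.robust_nonneg {M : Market} (A : OnlineAlg M) : 0 ≤ A.robust :=
  Real.sInf_nonneg (by rintro _ ⟨J, rfl⟩; exact A.perf_nonneg J)

lemma OnlineAlg.le_robust {M : Market} (A : OnlineAlg M) {c : ℝ} (h : ∀ I, c ≤ A.perf I) :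
    c ≤ A.robust :=
  le_csInf (Set.range_nonempty _) (by rintro _ ⟨J, rfl⟩; exact h J)

lemma exists_demands_eq {x y : ℝ} (hx : 0 ≤ x) (hy : 0 ≤ y) :
    ∃ I, lowDemand I = x ∧ highDemand I = y :=
  ⟨single Kind.low x ++ single Kind.high y, by
    simp [lowDemand_append, lowDemand_single_low hx, lowDemand_single_high], by
    simp [highDemand_append, highDemand_single_low, highDemand_single_high hy]⟩

lemma OnlineAlg.le_consis {M : Market} (A : OnlineAlg M) {R : Set (ℝ × ℝ)} (hne : R.Nonempty)
    (hnonneg : ∀ z ∈ R, 0 ≤ z.1 ∧ 0 ≤ z.2) {c : ℝ}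
    (h : ∀ I, (lowDemand I, highDemand I) ∈ R → c ≤ A.perf I) : c ≤ A.consis R := by
  refine le_csInf ?_ (by rintro _ ⟨J, hJ, rfl⟩; exact h J hJ)
  obtain ⟨⟨x, y⟩, hz⟩ := hne
  obtain ⟨I, rfl, rfl⟩ := exists_demands_eq (hnonneg _ hz).1 (hnonneg _ hz).2
  exact ⟨_, I, hz, rfl⟩

/-! ### Expected protection levels of an online algorithm -/

/-- The protection level `p` at low-reward demand `x` is compatible with the ratio `c` for all
demand vectors `(x, y)` of the region. -/
def Market.Compat (M : Market) (R : Set (ℝ × ℝ)) (c x p : ℝ) : Prop :=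
  p ∈ Set.Icc 0 M.m ∧ M.m - x ≤ p ∧
    ∀ y, 0 ≤ y → (x, y) ∈ R → c * M.opt x y ≤ min y p * M.rh + (M.m - p) * M.rl

/-- After the low-reward requests, append a high-reward request of size `y`: in expectation it
receives at most `min y (m - g)`. -/
lemma OnlineAlg.compat_of_total {M : Market} (A : OnlineAlg M) {R : Set (ℝ × ℝ)} {c : ℝ}
    (hA : ∀ I, (lowDemand I, highDemand I) ∈ R → c ≤ A.perf I) {I : List Request} {x g : ℝ}
    (hg0 : 0 ≤ g) (hgx : g ≤ x) (hlow : lowDemand I = x) (hhigh : highDemand I = 0)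
    (hone : A.total (fun _ => 1) I = g) (hrate : A.total M.rate I = M.rl * g) :
    M.Compat R c x (M.m - g) := by
  have hgm : g ≤ M.m := hone ▸ A.total_one_le I
  refine ⟨⟨by linarith, by linarith⟩, by linarith, fun y hy hR => ?_⟩
  obtain ⟨d, hd0, hdy, hd⟩ := A.exists_total_append_single I Kind.high hy
  have hl : lowDemand (I ++ single Kind.high y) = x := by
    rw [lowDemand_append, lowDemand_single_high, hlow, add_zero]
  have hh : highDemand (I ++ single Kind.high y) = y := by
    rw [highDemand_append, highDemand_single_high hy, hhigh, zero_add]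
  have hperf := hA (I ++ single Kind.high y) (by rw [hl, hh]; exact hR)
  have h1 : A.reward (I ++ single Kind.high y) = M.rl * g + M.rh * d := by
    rw [A.reward_eq_total, hd, hrate]
    rfl
  have hcap := A.total_one_le (I ++ single Kind.high y)
  rw [hd, hone, one_mul] at hcap
  have hmul := M.mul_opt_le (lowDemand_nonneg _) (highDemand_nonneg _) (A.reward_nonneg _) hperf
  rw [hl, hh, h1] at hmul
  have h2 : d ≤ min y (M.m - g) := le_min hdy (by linarith)
  have := mul_le_mul_of_nonneg_right h2 M.rh_pos.le
  linarith

/-- At two low-reward demands an online algorithm has protection levels that are compatible with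
all its performance guarantees. -/
lemma OnlineAlg.exists_levels {M : Market} (A : OnlineAlg M) {s t : ℝ}
    (hs : 0 ≤ s) (hst : s ≤ t) :
    ∃ p q, q ≤ p ∧ p ≤ q + (t - s) ∧ ∀ (R : Set (ℝ × ℝ)) (c : ℝ),
      (∀ I, (lowDemand I, highDemand I) ∈ R → c ≤ A.perf I) →
        M.Compat R c s p ∧ M.Compat R c t q := by
  obtain ⟨d, hd0, hds, hd⟩ := A.exists_total_append_single [] Kind.low hs
  obtain ⟨e, he0, het, he⟩ :=
    A.exists_total_append_single ([] ++ single Kind.low s) Kind.low (sub_nonneg.2 hst)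
  simp only [A.total_nil, zero_add, List.nil_append] at hd he
  -- The levels are the expected remaining resources after low-reward demands `s` and `t`. They are
  -- fixed before `R` and `c`, so one pair serves all guarantees at once.
  refine ⟨M.m - d, M.m - (d + e), by linarith, by linarith, fun R c hA => ⟨?_, ?_⟩⟩
  · exact A.compat_of_total hA hd0 hds (lowDemand_single_low hs) (highDemand_single_low s)
      (by rw [hd, one_mul]) (hd _)
  · refine A.compat_of_total hA (I := single Kind.low s ++ single Kind.low (t - s))
      (by linarith) (by linarith) ?_ ?_ (by rw [he, hd]; ring)
      (by rw [he, hd]; simp only [Market.rate]; ring)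
    · rw [lowDemand_append, lowDemand_single_low hs, lowDemand_single_low (sub_nonneg.2 hst)]
      ring
    · rw [highDemand_append, highDemand_single_low, highDemand_single_low, add_zero]

lemma OnlineAlg.exists_compat {M : Market} (A : OnlineAlg M) {R : Set (ℝ × ℝ)} {c : ℝ}
    (hA : ∀ I, (lowDemand I, highDemand I) ∈ R → c ≤ A.perf I) {s t : ℝ}
    (hs : 0 ≤ s) (hst : s ≤ t) :
    ∃ p q, M.Compat R c s p ∧ M.Compat R c t q ∧ q ≤ p ∧ p ≤ q + (t - s) := by
  obtain ⟨p, q, h1, h2, h⟩ := A.exists_levels hs hst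
  exact ⟨p, q, (h R c hA).1, (h R c hA).2, h1, h2⟩

lemma Market.Compat.le_one_of_opt_pos {M : Market} {R : Set (ℝ × ℝ)} {c x p y : ℝ}
    (h : M.Compat R c x p) (hy : 0 ≤ y) (hR : (x, y) ∈ R) (hpos : 0 < M.opt x y) : c ≤ 1 := by
  obtain ⟨⟨hp0, hpm⟩, hxp, h⟩ := h
  have h1 := h y hy hR
  have h2 : min y p ≤ min y M.m := min_le_min_left _ hpm
  -- Low-reward units sold beyond the clairvoyant number are matched by high-reward units lost.
  have h3 : M.m - p ≤ min x (max (M.m - y) 0) + (min y M.m - min y p) := by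
    simp only [min_def, max_def]
    split_ifs <;> linarith
  have := M.rl_pos
  have := M.rl_lt_rh
  have h4 : min y p * M.rh + (M.m - p) * M.rl ≤ M.opt x y := by
    unfold Market.opt
    nlinarith
  by_contra! hc
  nlinarith

lemma OnlineAlg.le_one {M : Market} (A : OnlineAlg M) {R : Set (ℝ × ℝ)} (hne : R.Nonempty)
    (hnonneg : ∀ z ∈ R, 0 ≤ z.1 ∧ 0 ≤ z.2) {c : ℝ}
    (hA : ∀ I, (lowDemand I, highDemand I) ∈ R → c ≤ A.perf I) : c ≤ 1 := by
  obtain ⟨⟨x, y⟩, hz⟩ := hne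
  obtain ⟨hx, hy⟩ := hnonneg _ hz
  rcases (M.opt_nonneg hx hy).eq_or_lt with h0 | hpos
  · obtain ⟨I, rfl, rfl⟩ := exists_demands_eq hx hy
    have := hA I hz
    rwa [OnlineAlg.perf, Market.ratio, if_pos h0.symm] at this
  · obtain ⟨p, -, hp, -⟩ := A.exists_compat hA hx le_rfl
    exact hp.le_one_of_opt_pos hy hz hpos

/-- Compatible pairs of protection levels survive the passage to the limit in the ratio. -/
lemma Market.exists_compat_of_forall_lt (M : Market) {R : Set (ℝ × ℝ)} {C s t : ℝ}
    (h : ∀ c < C, ∃ p q, M.Compat R c s p ∧ M.Compat R c t q ∧ q ≤ p ∧ p ≤ q + (t - s)) :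
    ∃ p q, M.Compat R C s p ∧ M.Compat R C t q ∧ q ≤ p ∧ p ≤ q + (t - s) := by
  have hlt : ∀ n : ℕ, C - 1 / ((n : ℝ) + 1) < C := fun n => by
    have : (0 : ℝ) < 1 / ((n : ℝ) + 1) := by positivity
    linarith
  choose p q hp hq hqp hpq using fun n : ℕ => h _ (hlt n)
  have hc : Filter.Tendsto (fun n : ℕ => C - 1 / ((n : ℝ) + 1)) Filter.atTop (nhds C) := by
    simpa using tendsto_const_nhds.sub (tendsto_one_div_add_atTop_nhds_zero_nat (𝕜 := ℝ))
  -- The levels stay in a compact square, and every condition on them is closed.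
  obtain ⟨⟨a, b⟩, hab, φ, hφ, hlim⟩ :=
    (isCompact_Icc.prod isCompact_Icc : IsCompact (Set.Icc 0 M.m ×ˢ Set.Icc 0 M.m)).tendsto_subseq
      (x := fun n => (p n, q n)) (fun n => ⟨(hp n).1, (hq n).1⟩)
  have ha : Filter.Tendsto (fun n => p (φ n)) Filter.atTop (nhds a) :=
    (continuous_fst.tendsto _).comp hlim
  have hb : Filter.Tendsto (fun n => q (φ n)) Filter.atTop (nhds b) :=
    (continuous_snd.tendsto _).comp hlim
  have hcφ := hc.comp hφ.tendsto_atTop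
  refine ⟨a, b, ⟨hab.1, ge_of_tendsto' ha fun n => (hp _).2.1, fun y hy hR => ?_⟩,
    ⟨hab.2, ge_of_tendsto' hb fun n => (hq _).2.1, fun y hy hR => ?_⟩,
    le_of_tendsto_of_tendsto' hb ha fun n => hqp _,
    le_of_tendsto_of_tendsto' ha (hb.add_const _) fun n => hpq _⟩
  · exact le_of_tendsto_of_tendsto' (hcφ.mul_const _)
      (((tendsto_const_nhds.min ha).mul_const _).add ((tendsto_const_nhds.sub ha).mul_const _))
      fun n => (hp (φ n)).2.2 y hy hR
  · exact le_of_tendsto_of_tendsto' (hcφ.mul_const _)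
      (((tendsto_const_nhds.min hb).mul_const _).add ((tendsto_const_nhds.sub hb).mul_const _))
      fun n => (hq (φ n)).2.2 y hy hR

section

/-! ### The pointwise consistency bounds -/

variable {M : Market} {R : Set (ℝ × ℝ)} {C x y p : ℝ}

lemma cappedFiber_subset (hnonneg : ∀ z ∈ R, 0 ≤ z.1 ∧ 0 ≤ z.2) (x : ℝ) :
    {h | ∃ y, (x, y) ∈ R ∧ h = min y M.m} ⊆ Set.Icc 0 M.m := by
  rintro _ ⟨y, hy, rfl⟩
  exact ⟨le_min (hnonneg _ hy).2 M.m_pos.le, min_le_right _ _⟩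

lemma cappedFiber_nonempty (hx : x ∈ proj R) :
    {h | ∃ y, (x, y) ∈ R ∧ h = min y M.m}.Nonempty := by
  obtain ⟨⟨_, y⟩, hz, rfl⟩ := hx
  exact ⟨_, y, hz, rfl⟩

lemma lowEnv_mem_closure (hnonneg : ∀ z ∈ R, 0 ≤ z.1 ∧ 0 ≤ z.2) (hx : x ∈ proj R) :
    M.lowEnv R x ∈ closure {h | ∃ y, (x, y) ∈ R ∧ h = min y M.m} :=
  csInf_mem_closure (cappedFiber_nonempty hx) (bddBelow_Icc.mono (cappedFiber_subset hnonneg x))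

lemma upEnv_mem_closure (hnonneg : ∀ z ∈ R, 0 ≤ z.1 ∧ 0 ≤ z.2) (hx : x ∈ proj R) :
    M.upEnv R x ∈ closure {h | ∃ y, (x, y) ∈ R ∧ h = min y M.m} :=
  csSup_mem_closure (cappedFiber_nonempty hx) (bddAbove_Icc.mono (cappedFiber_subset hnonneg x))

lemma lowEnv_mem_Icc (hnonneg : ∀ z ∈ R, 0 ≤ z.1 ∧ 0 ≤ z.2) (hx : x ∈ proj R) :
    M.lowEnv R x ∈ Set.Icc 0 M.m :=
  closure_minimal (cappedFiber_subset hnonneg x) isClosed_Icc (lowEnv_mem_closure hnonneg hx)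

lemma upEnv_mem_Icc (hnonneg : ∀ z ∈ R, 0 ≤ z.1 ∧ 0 ≤ z.2) (hx : x ∈ proj R) :
    M.upEnv R x ∈ Set.Icc 0 M.m :=
  closure_minimal (cappedFiber_subset hnonneg x) isClosed_Icc (upEnv_mem_closure hnonneg hx)

lemma lowEnv_le (hnonneg : ∀ z ∈ R, 0 ≤ z.1 ∧ 0 ≤ z.2) (hy : (x, y) ∈ R) :
    M.lowEnv R x ≤ min y M.m :=
  csInf_le (bddBelow_Icc.mono (cappedFiber_subset hnonneg x)) ⟨y, hy, rfl⟩

lemma le_upEnv (hnonneg : ∀ z ∈ R, 0 ≤ z.1 ∧ 0 ≤ z.2) (hy : (x, y) ∈ R) :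
    min y M.m ≤ M.upEnv R x :=
  le_csSup (bddAbove_Icc.mono (cappedFiber_subset hnonneg x)) ⟨y, hy, rfl⟩

lemma proj_nonneg (hnonneg : ∀ z ∈ R, 0 ≤ z.1 ∧ 0 ≤ z.2) (hx : x ∈ proj R) : 0 ≤ x := by
  obtain ⟨z, hz, rfl⟩ := hx
  exact (hnonneg _ hz).1

/-- The envelopes need not be attained, but the reward inequality is closed in the high-reward
demand. Capping that demand at `m` changes neither side because `p ≤ m`. -/
lemma Market.Compat.mul_opt_le_of_mem_closure (h : M.Compat R C x p)
    (hnonneg : ∀ z ∈ R, 0 ≤ z.1 ∧ 0 ≤ z.2) {e : ℝ}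
    (he : e ∈ closure {h | ∃ y, (x, y) ∈ R ∧ h = min y M.m}) :
    C * M.opt x e ≤ min e p * M.rh + (M.m - p) * M.rl := by
  have hcl : IsClosed {e | C * M.opt x e ≤ min e p * M.rh + (M.m - p) * M.rl} :=
    isClosed_le (continuous_const.mul (M.continuous_opt x)) (by fun_prop)
  refine closure_minimal ?_ hcl he
  rintro _ ⟨y, hy, rfl⟩
  have := h.2.2 y (hnonneg _ hy).2 hy
  rw [Set.mem_ofPred_eq, M.opt_min, min_assoc, min_eq_right h.1.2]
  exact this

lemma uPt_mem_Icc : M.uPt R C x ∈ Set.Icc 0 M.m := by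
  refine ⟨Real.sSup_nonneg fun p hp => hp.1.1, Real.sSup_le (fun p hp => hp.1.2) M.m_pos.le⟩

lemma lPt_mem_Icc : M.lPt R C x ∈ Set.Icc 0 M.m := by
  refine ⟨Real.sInf_nonneg fun p hp => hp.1.1, ?_⟩
  unfold Market.lPt
  -- If no level is admissible, the infimum is `0` by convention and still lies in the interval.
  rcases Set.eq_empty_or_nonempty {p | p ∈ Set.Icc 0 M.m ∧ C ≤ M.CPu p x (M.upEnv R x)}
    with h | ⟨p, hp⟩
  · rw [h, Real.sInf_empty]
    exact M.m_pos.le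
  · exact (csInf_le ⟨0, fun q hq => hq.1.1⟩ hp).trans hp.1.2

lemma Market.Compat.le_uPt (h : M.Compat R C x p) (hnonneg : ∀ z ∈ R, 0 ≤ z.1 ∧ 0 ≤ z.2)
    (hx : x ∈ proj R) (hC1 : C ≤ 1) : p ≤ M.uPt R C x := by
  have he := lowEnv_mem_Icc (M := M) hnonneg hx
  refine le_csSup ⟨M.m, fun q hq => hq.1.2⟩
    ⟨h.1, M.le_ratio (proj_nonneg hnonneg hx) he.1 hC1 ?_⟩
  refine (h.mul_opt_le_of_mem_closure hnonneg (lowEnv_mem_closure hnonneg hx)).trans ?_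
  have h1 : min (M.lowEnv R x) p ≤ min (M.lowEnv R x) M.m := min_le_min_left _ h.1.2
  have h2 : M.m - p ≤ min x (max (M.m - p) 0) := le_min (by linarith [h.2.1]) (le_max_left _ _)
  gcongr
  exacts [M.rh_pos.le, M.rl_pos.le]

lemma Market.Compat.lPt_le (h : M.Compat R C x p) (hnonneg : ∀ z ∈ R, 0 ≤ z.1 ∧ 0 ≤ z.2)
    (hx : x ∈ proj R) (hC1 : C ≤ 1) : M.lPt R C x ≤ p := by
  have he := upEnv_mem_Icc (M := M) hnonneg hx
  refine csInf_le ⟨0, fun q hq => hq.1.1⟩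
    ⟨h.1, M.le_ratio (proj_nonneg hnonneg hx) he.1 hC1 ?_⟩
  refine (h.mul_opt_le_of_mem_closure hnonneg (upEnv_mem_closure hnonneg hx)).trans ?_
  have h1 : min (M.upEnv R x) p ≤ max p (min (M.upEnv R x) (max (M.m - x) 0)) :=
    (min_le_right _ _).trans (le_max_left _ _)
  have h2 : M.m - p ≤ min x (M.m - p) := le_min (by linarith [h.2.1]) le_rfl
  gcongr
  exacts [M.rh_pos.le, M.rl_pos.le]

/-- Below the upper bound the over-protected reward is large enough on the whole fiber. -/
lemma mul_opt_le_of_le_uPt (hnonneg : ∀ z ∈ R, 0 ≤ z.1 ∧ 0 ≤ z.2) (hC0 : 0 ≤ C) (hC1 : C ≤ 1)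
    (hp : p ≤ M.uPt R C x) (hy : (x, y) ∈ R) (hym : y ≤ M.m) :
    C * M.opt x y ≤ y * M.rh + min x (M.m - p) * M.rl := by
  have hx : x ∈ proj R := ⟨_, hy, rfl⟩
  have hx0 := proj_nonneg hnonneg hx
  have hy0 := (hnonneg _ hy).2
  obtain ⟨he0, hem⟩ := lowEnv_mem_Icc (M := M) hnonneg hx
  set e := M.lowEnv R x with he
  have hey : e ≤ y := (lowEnv_le hnonneg hy).trans (min_le_left _ _)
  have hrl := M.rl_pos
  have hlh := M.rl_lt_rh
  set S := {q | q ∈ Set.Icc 0 M.m ∧ C ≤ M.CPo q x e} with hS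
  have hne : S.Nonempty := by
    refine ⟨0, ⟨le_rfl, M.m_pos.le⟩, M.le_ratio hx0 he0 hC1 ?_⟩
    have h1 : M.opt x e ≤ min e M.m * M.rh + min x (max (M.m - 0) 0) * M.rl := by
      unfold Market.opt
      gcongr
    exact (mul_le_of_le_one_left (M.opt_nonneg hx0 he0) hC1).trans h1
  -- A closed superset of `S` transfers the reward inequality to the supremum `uPt`.
  have hsub : S ⊆ {q | q ≤ M.m ∧ C * M.opt x e ≤ e * M.rh + min x (M.m - q) * M.rl} := by
    rintro q ⟨⟨hq0, hqm⟩, hq⟩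
    refine ⟨hqm, ?_⟩
    have h := M.mul_opt_le hx0 he0 ?_ hq
    · rwa [min_eq_left hem, max_eq_left (by linarith)] at h
    · have : 0 ≤ min x (max (M.m - q) 0) := le_min hx0 (le_max_right _ _)
      have := M.rh_pos
      rw [min_eq_left hem]
      positivity
  have hcont : Continuous fun q => e * M.rh + min x (M.m - q) * M.rl := by fun_prop
  have hcl : IsClosed {q | q ≤ M.m ∧ C * M.opt x e ≤ e * M.rh + min x (M.m - q) * M.rl} :=
    (isClosed_le continuous_id continuous_const).inter (isClosed_le continuous_const hcont)
  have hsup := closure_minimal hsub hcl (csSup_mem_closure hne ⟨M.m, fun q hq => hq.1.2⟩)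
  have h1 : C * M.opt x e ≤ e * M.rh + min x (M.m - p) * M.rl := by
    refine hsup.2.trans ?_
    gcongr
    exact hp
  -- From the lower envelope up to `y`, the algorithm's reward gains exactly `(y - e) * rh`, while
  -- the clairvoyant reward gains no more.
  have h2 : M.opt x y ≤ M.opt x e + (y - e) * M.rh := by
    have : min x (max (M.m - y) 0) ≤ min x (max (M.m - e) 0) := by gcongr
    unfold Market.opt
    rw [min_eq_left hem, min_eq_left hym]
    nlinarith
  have h3 : C * ((y - e) * M.rh) ≤ (y - e) * M.rh :=
    mul_le_of_le_one_left (mul_nonneg (by linarith) M.rh_pos.le) hC1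
  nlinarith

/-- Above the lower bound the under-protected reward is large enough on the whole fiber. -/
lemma mul_opt_le_of_lPt_le (hnonneg : ∀ z ∈ R, 0 ≤ z.1 ∧ 0 ≤ z.2) (hC0 : 0 ≤ C) (hC1 : C ≤ 1)
    (hp : M.lPt R C x ≤ p) (hy : (x, y) ∈ R) :
    C * M.opt x y ≤ max p (M.m - x) * M.rh + min x (M.m - p) * M.rl := by
  have hx : x ∈ proj R := ⟨_, hy, rfl⟩
  have hx0 := proj_nonneg hnonneg hx
  obtain ⟨he0, hem⟩ := upEnv_mem_Icc (M := M) hnonneg hx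
  have hye : min y M.m ≤ M.upEnv R x := le_upEnv hnonneg hy
  set e := M.upEnv R x with he
  have hrl := M.rl_pos
  have hlh := M.rl_lt_rh
  set S := {q | q ∈ Set.Icc 0 M.m ∧ C ≤ M.CPu q x e} with hS
  have hne : S.Nonempty := by
    refine ⟨M.m, ⟨M.m_pos.le, le_rfl⟩, M.le_ratio hx0 he0 hC1 ?_⟩
    have h1 : M.m * M.rh ≤ max M.m (min e (max (M.m - x) 0)) * M.rh
        + min x (M.m - M.m) * M.rl := by
      rw [sub_self, min_eq_right hx0, zero_mul, add_zero]
      exact mul_le_mul_of_nonneg_right (le_max_left _ _) M.rh_pos.le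
    exact (mul_le_of_le_one_left (M.opt_nonneg hx0 he0) hC1).trans ((M.opt_le hx0 e).trans h1)
  have hsub : S ⊆ {q | q ∈ Set.Icc 0 M.m ∧
      C * M.opt x e ≤ max q (M.m - x) * M.rh + min x (M.m - q) * M.rl} := by
    rintro q ⟨⟨hq0, hqm⟩, hq⟩
    refine ⟨⟨hq0, hqm⟩, ?_⟩
    have hq1 : 0 ≤ max q (min e (max (M.m - x) 0)) := hq0.trans (le_max_left _ _)
    have hq2 : 0 ≤ min x (M.m - q) := le_min hx0 (by linarith)
    refine (M.mul_opt_le hx0 he0 ?_ hq).trans ?_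
    · have := M.rh_pos
      positivity
    -- The cap `e` can be dropped: the lemma serves the case of an exhausted resource, where the
    -- larger expression is earned.
    · have : max q (min e (max (M.m - x) 0)) ≤ max q (M.m - x) :=
        max_le (le_max_left _ _) ((min_le_right _ _).trans
          (max_le (le_max_right _ _) (hq0.trans (le_max_left _ _))))
      have := M.rh_pos
      gcongr
  have hcont : Continuous fun q => max q (M.m - x) * M.rh + min x (M.m - q) * M.rl := by
    fun_prop
  have hcl : IsClosed {q | q ∈ Set.Icc 0 M.m ∧
      C * M.opt x e ≤ max q (M.m - x) * M.rh + min x (M.m - q) * M.rl} :=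
    isClosed_Icc.inter (isClosed_le continuous_const hcont)
  have hinf := closure_minimal hsub hcl (csInf_mem_closure hne ⟨0, fun q hq => hq.1.1⟩)
  have h1 : M.opt x y ≤ M.opt x e := by
    rw [← M.opt_min]
    exact M.opt_mono x hye
  refine (mul_le_mul_of_nonneg_left h1 hC0).trans (hinf.2.trans ?_)
  change M.lPt R C x ∈ Set.Icc 0 M.m ∧ _ at hinf
  change max (M.lPt R C x) (M.m - x) * M.rh + min x (M.m - M.lPt R C x) * M.rl ≤ _
  set q := M.lPt R C x
  -- Both maxima equal `m` minus the low-reward amount, so raising the level exchanges low-reward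
  -- for high-reward units one for one.
  have h2 : min x (M.m - q) - min x (M.m - p) = max p (M.m - x) - max q (M.m - x) := by
    simp only [min_def, max_def]
    split_ifs <;> linarith
  have h3 : max q (M.m - x) ≤ max p (M.m - x) := max_le_max_right _ hp
  nlinarith

/-! ### The consistency bound functions -/

lemma l_nonempty (x : ℝ) : ({0} ∪ M.lPt R C '' (proj R ∩ Set.Ici x)).Nonempty := ⟨0, Or.inl rfl⟩

lemma l_bddAbove (x : ℝ) : BddAbove ({0} ∪ M.lPt R C '' (proj R ∩ Set.Ici x)) := by
  refine ⟨M.m, ?_⟩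
  rintro _ (rfl | ⟨t, -, rfl⟩)
  exacts [M.m_pos.le, lPt_mem_Icc.2]

lemma u_bddBelow (x : ℝ) : BddBelow ({M.m} ∪ M.uPt R C '' (proj R ∩ Set.Iic x)) := by
  refine ⟨0, ?_⟩
  rintro _ (rfl | ⟨t, -, rfl⟩)
  exacts [M.m_pos.le, uPt_mem_Icc.1]

lemma l_nonneg : 0 ≤ M.l R C x := le_csSup (l_bddAbove x) (Or.inl rfl)

lemma lPt_le_l {t : ℝ} (ht : t ∈ proj R) (h : x ≤ t) : M.lPt R C t ≤ M.l R C x :=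
  le_csSup (l_bddAbove x) (Or.inr ⟨t, ⟨ht, h⟩, rfl⟩)

lemma l_le {b : ℝ} (hb : 0 ≤ b) (h : ∀ t ∈ proj R, x ≤ t → M.lPt R C t ≤ b) :
    M.l R C x ≤ b := by
  refine csSup_le (l_nonempty x) ?_
  rintro _ (rfl | ⟨t, ht, rfl⟩)
  exacts [hb, h t ht.1 ht.2]

lemma l_le_m : M.l R C x ≤ M.m := l_le M.m_pos.le fun _ _ _ => lPt_mem_Icc.2

lemma l_antitone : Antitone (M.l R C) := fun _ _ h =>
  l_le l_nonneg fun _ ht hyt => lPt_le_l ht (h.trans hyt)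

lemma u_le_m : M.u R C x ≤ M.m := csInf_le (u_bddBelow x) (Or.inl rfl)

lemma u_le_uPt {t : ℝ} (ht : t ∈ proj R) (h : t ≤ x) : M.u R C x ≤ M.uPt R C t :=
  csInf_le (u_bddBelow x) (Or.inr ⟨t, ⟨ht, h⟩, rfl⟩)

lemma le_u {b : ℝ} (hb : b ≤ M.m) (h : ∀ t ∈ proj R, t ≤ x → b ≤ M.uPt R C t) :
    b ≤ M.u R C x := by
  refine le_csInf ⟨M.m, Or.inl rfl⟩ ?_
  rintro _ (rfl | ⟨t, ht, rfl⟩)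
  exacts [hb, h t ht.1 ht.2]

lemma u_antitone : Antitone (M.u R C) := fun _ _ h =>
  le_u u_le_m fun _ ht hty => u_le_uPt ht (hty.trans h)

lemma lTilde_bddAbove (x : ℝ) :
    BddAbove ((fun t => max (M.l R C t - (x - t)) 0) '' Set.Icc 0 x) := by
  refine ⟨M.m, ?_⟩
  rintro _ ⟨t, ht, rfl⟩
  exact max_le (by linarith [ht.2, l_le_m (M := M) (R := R) (C := C) (x := t)]) M.m_pos.le

lemma lTilde_nonneg : 0 ≤ M.lTilde R C x :=
  Real.sSup_nonneg (by rintro _ ⟨t, -, rfl⟩; exact le_max_right _ _)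

lemma le_lTilde {t : ℝ} (ht : 0 ≤ t) (htx : t ≤ x) : M.l R C t - (x - t) ≤ M.lTilde R C x :=
  (le_max_left _ _).trans (le_csSup (lTilde_bddAbove x) ⟨t, ⟨ht, htx⟩, rfl⟩)

lemma l_le_lTilde (hx : 0 ≤ x) : M.l R C x ≤ M.lTilde R C x := by
  simpa using le_lTilde (M := M) (R := R) (C := C) hx le_rfl

lemma lTilde_le {b : ℝ} (hb : 0 ≤ b)
    (h : ∀ t, 0 ≤ t → t ≤ x → M.l R C t ≤ b + (x - t)) : M.lTilde R C x ≤ b := by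
  refine Real.sSup_le ?_ hb
  rintro _ ⟨t, ht, rfl⟩
  exact max_le (by linarith [h t ht.1 ht.2]) hb

/-- Unfolding both suprema leaves values `lPt t' - (x - t)` with `t ≤ x` and `t ≤ t'`, and `x - t`
is at least the positive part of `x - t'`. Bounds on `lTilde` thus reduce to comparing two demands,
which is what pairs of levels provide. -/
lemma lTilde_le_of_lPt_le {b : ℝ} (hb : 0 ≤ b)
    (h : ∀ t ∈ proj R, M.lPt R C t ≤ b + max (x - t) 0) : M.lTilde R C x ≤ b := by
  refine lTilde_le hb fun t _ htx => l_le (by linarith) fun t' ht' htt' => ?_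
  exact (h t' ht').trans (by gcongr; exact max_le (by linarith) (by linarith))

lemma lTilde_le_m : M.lTilde R C x ≤ M.m :=
  lTilde_le M.m_pos.le fun t _ htx => l_le_m.trans (by linarith)

lemma lTilde_anti {y : ℝ} (hx : 0 ≤ x) (hxy : x ≤ y) : M.lTilde R C y ≤ M.lTilde R C x := by
  refine lTilde_le lTilde_nonneg fun t ht hty => ?_
  rcases le_total t x with h | h
  · linarith [le_lTilde (M := M) (R := R) (C := C) ht h]
  · linarith [l_antitone (M := M) (R := R) (C := C) h,
      l_le_lTilde (M := M) (R := R) (C := C) hx]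

lemma lTilde_slope {y : ℝ} (hxy : x ≤ y) : M.lTilde R C x - (y - x) ≤ M.lTilde R C y := by
  have h : M.lTilde R C x ≤ M.lTilde R C y + (y - x) :=
    lTilde_le (by linarith [lTilde_nonneg (M := M) (R := R) (C := C) (x := y)]) fun t ht htx => by
      linarith [le_lTilde (M := M) (R := R) (C := C) ht (htx.trans hxy)]
  linarith

lemma xmin_le (hnonneg : ∀ z ∈ R, 0 ≤ z.1 ∧ 0 ≤ z.2) (hx : x ∈ proj R) : xmin R ≤ x :=
  csInf_le ⟨0, fun _ ht => proj_nonneg hnonneg ht⟩ hx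

lemma xmin_nonneg (hnonneg : ∀ z ∈ R, 0 ≤ z.1 ∧ 0 ≤ z.2) : 0 ≤ xmin R :=
  Real.sInf_nonneg fun _ ht => proj_nonneg hnonneg ht

lemma lTilde_le_xmin (hnonneg : ∀ z ∈ R, 0 ≤ z.1 ∧ 0 ≤ z.2) (x : ℝ) :
    M.lTilde R C x ≤ M.lTilde R C (xmin R) := by
  refine lTilde_le lTilde_nonneg fun t _ htx => ?_
  have h : M.l R C t ≤ M.l R C (xmin R) :=
    l_le l_nonneg fun t' ht' _ => lPt_le_l ht' (xmin_le hnonneg ht')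
  linarith [l_le_lTilde (M := M) (R := R) (C := C) (xmin_nonneg hnonneg)]

lemma u_eq_of_lt_xmin (hnonneg : ∀ z ∈ R, 0 ≤ z.1 ∧ 0 ≤ z.2) (hx : x < xmin R) :
    M.u R C x = M.m :=
  le_antisymm u_le_m (le_u le_rfl fun _ ht htx =>
    absurd (xmin_le hnonneg ht) (not_le.2 (htx.trans_lt hx)))

/-- Pairs of compatible protection levels separate the two bound functions. -/
lemma lTilde_le_u (hnonneg : ∀ z ∈ R, 0 ≤ z.1 ∧ 0 ≤ z.2) (hC1 : C ≤ 1)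
    (h : ∀ s t, 0 ≤ s → s ≤ t →
      ∃ p q, M.Compat R C s p ∧ M.Compat R C t q ∧ q ≤ p ∧ p ≤ q + (t - s)) (x : ℝ) :
    M.lTilde R C x ≤ M.u R C x := by
  -- It remains to bound `lPt t` by `uPt s + max (x - t) 0` with `s ≤ x`. Monotonicity of the levels
  -- settles `s ≤ t`, the slope bound settles `t ≤ s`.
  refine le_u lTilde_le_m fun s hs hsx =>
    lTilde_le_of_lPt_le uPt_mem_Icc.1 fun t ht => ?_
  rcases le_total s t with hst | hts
  · obtain ⟨p, q, hp, hq, hqp, -⟩ := h s t (proj_nonneg hnonneg hs) hst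
    linarith [hp.le_uPt hnonneg hs hC1, hq.lPt_le hnonneg ht hC1, le_max_right (x - t) 0]
  · obtain ⟨p, q, hp, hq, -, hpq⟩ := h t s (proj_nonneg hnonneg ht) hts
    linarith [hp.lPt_le hnonneg ht hC1, hq.le_uPt hnonneg hs hC1, le_max_left (x - t) 0]

lemma Market.exists_alg_of_lt_Cstar (M : Market) {R : Set (ℝ × ℝ)} {c : ℝ}
    (hc : c < M.Cstar R) :
    ∃ A : OnlineAlg M, ∀ I, (lowDemand I, highDemand I) ∈ R → c ≤ A.perf I := by
  obtain ⟨_, ⟨A, rfl⟩, hA⟩ := exists_lt_of_lt_csSup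
    (Set.range_nonempty_iff_nonempty.2 ⟨(M.pla fun _ => 0).toOnline⟩) hc
  exact ⟨A, fun I hI => hA.le.trans (A.consis_le_perf hI)⟩

lemma Market.le_one_of_le_Cstar (M : Market) {R : Set (ℝ × ℝ)} (hne : R.Nonempty)
    (hnonneg : ∀ z ∈ R, 0 ≤ z.1 ∧ 0 ≤ z.2) {C : ℝ} (hC : C ≤ M.Cstar R) : C ≤ 1 := by
  refine le_of_forall_lt fun c hc => ?_
  obtain ⟨d, hcd, hdC⟩ := exists_between hc
  obtain ⟨A, hA⟩ := M.exists_alg_of_lt_Cstar (hdC.trans_le hC)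
  exact hcd.trans_le (A.le_one hne hnonneg hA)

lemma Market.lTilde_le_u_of_le_Cstar (M : Market) {R : Set (ℝ × ℝ)} (hne : R.Nonempty)
    (hnonneg : ∀ z ∈ R, 0 ≤ z.1 ∧ 0 ≤ z.2) {C : ℝ} (hC : C ≤ M.Cstar R) (x : ℝ) :
    M.lTilde R C x ≤ M.u R C x := by
  refine lTilde_le_u hnonneg (M.le_one_of_le_Cstar hne hnonneg hC) (fun s t hs hst => ?_) x
  refine M.exists_compat_of_forall_lt fun c hc => ?_
  obtain ⟨A, hA⟩ := M.exists_alg_of_lt_Cstar (hc.trans_le hC)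
  exact A.exists_compat hA hs hst

end

section

/-! ### Rewards of protection level algorithms -/

lemma toOnline_reward {M : Market} (A : DetAlg M) (I : List Request) :
    A.toOnline.reward I = A.reward I := by
  unfold OnlineAlg.reward DetAlg.toOnline
  simp

/-- Either all high-reward requests were served and the low-reward requests got exactly what the
protection level allows, or the resource is used up. -/
lemma Market.pla_invariant (M : Market) {p : ℝ → ℝ} (hp0 : ∀ x, 0 ≤ x → 0 ≤ p x)
    (hpm : ∀ x, 0 ≤ x → p x ≤ M.m)
    (hp : ∀ x y, 0 ≤ x → x ≤ y → p y ≤ p x ∧ p x - (y - x) ≤ p y) (I : List Request) :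
    (M.plaState p I).lowSeen = lowDemand I ∧
    (M.pla p).reward I = (M.plaState p I).lowGiven * M.rl +
      ((M.plaState p I).used - (M.plaState p I).lowGiven) * M.rh ∧
    (((M.plaState p I).used - (M.plaState p I).lowGiven = highDemand I ∧
        (M.plaState p I).lowGiven = min (lowDemand I) (M.m - p (lowDemand I))) ∨
      ((M.plaState p I).used = M.m ∧
        (M.plaState p I).lowGiven ≤ min (lowDemand I) (M.m - p (lowDemand I)) ∧
        (M.plaState p I).used - (M.plaState p I).lowGiven ≤ highDemand I)) := by
  induction I using List.reverseRecOn with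
  | nil =>
    have h0 := hpm 0 le_rfl
    simp [Market.plaState, lowDemand, highDemand, DetAlg.reward, weightedTotal, h0]
  | append_singleton I q ih =>
    obtain ⟨ih1, ih2, ih3⟩ := ih
    have hrew : (M.pla p).reward (I ++ [q]) =
        (M.pla p).reward I + M.rate q.kind * M.plaGive p (M.plaState p I) q :=
      weightedTotal_append _ _ _ _
    have hused := M.plaState_used_le p I
    have hx0 := lowDemand_nonneg I
    rw [hrew, ih2, M.plaState_append, lowDemand_append, highDemand_append]
    generalize M.plaState p I = st at *
    generalize lowDemand I = x at *
    generalize highDemand I = y at *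
    obtain ⟨s, k, hs⟩ := q
    cases k with
    | high =>
      simp only [Market.plaStep, Market.plaGive, Market.rate, lowDemand, highDemand, List.map_cons,
        List.map_nil, List.sum_cons, List.sum_nil, Request.lowSize, Request.highSize, add_zero]
      refine ⟨ih1, by ring, ?_⟩
      rcases ih3 with ⟨h1, h2⟩ | ⟨h1, h2, h3⟩
      · rcases le_total s (M.m - st.used) with h | h
        · left
          rw [min_eq_left h]
          exact ⟨by linarith, h2⟩
        · right
          rw [min_eq_right h]
          exact ⟨by ring, h2.le, by linarith⟩
      · right
        rw [h1, sub_self, min_eq_right hs.le, add_zero]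
        rw [h1] at h3
        exact ⟨rfl, h2, by linarith⟩
    | low =>
      simp only [Market.plaStep, Market.plaGive, Market.rate, lowDemand, highDemand, List.map_cons,
        List.map_nil, List.sum_cons, List.sum_nil, Request.lowSize, Request.highSize, add_zero]
      rw [ih1]
      refine ⟨rfl, by ring, ?_⟩
      obtain ⟨hanti, hslope⟩ := hp x (x + s) hx0 (by linarith)
      have hpx := hpm x hx0
      have hpy := hp0 (x + s) (by linarith)
      rcases ih3 with ⟨h1, h2⟩ | ⟨h1, h2, h3⟩
      -- Slope at least `-1` means that the newly released amount never exceeds the request, so the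
      -- low-reward amount stays on its target; monotonicity means that the target never drops.
      · have hv : st.lowGiven + min (max (M.m - p (x + s) - st.lowGiven) 0) s =
            min (x + s) (M.m - p (x + s)) := by
          rw [h2]
          simp only [min_def, max_def]
          split_ifs <;> linarith
        rcases le_total (min (max (M.m - p (x + s) - st.lowGiven) 0) s) (M.m - st.used) with h | h
        · left
          rw [min_eq_right h, hv]
          exact ⟨by linarith, rfl⟩
        · right
          rw [min_eq_left h]
          exact ⟨by ring, by linarith, by linarith⟩
      · right
        have hv : 0 ≤ min (max (M.m - p (x + s) - st.lowGiven) 0) s :=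
          le_min (le_max_right _ _) hs.le
        rw [h1, sub_self, min_eq_left hv, add_zero, add_zero]
        rw [h1] at h3
        exact ⟨rfl, h2.trans (min_le_min (by linarith) (by linarith)), h3⟩

/-- Once the resource is exhausted, every unit not given to low-reward requests earned `rh`;
replacing the low-reward amount by its upper bound only lowers the reward. -/
lemma Market.pla_reward (M : Market) {p : ℝ → ℝ} (hp0 : ∀ x, 0 ≤ x → 0 ≤ p x)
    (hpm : ∀ x, 0 ≤ x → p x ≤ M.m)
    (hp : ∀ x y, 0 ≤ x → x ≤ y → p y ≤ p x ∧ p x - (y - x) ≤ p y) (I : List Request) :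
    (highDemand I ≤ M.m ∧ (M.pla p).toOnline.reward I =
      highDemand I * M.rh + min (lowDemand I) (M.m - p (lowDemand I)) * M.rl) ∨
    max (p (lowDemand I)) (M.m - lowDemand I) * M.rh +
      min (lowDemand I) (M.m - p (lowDemand I)) * M.rl ≤ (M.pla p).toOnline.reward I := by
  obtain ⟨-, h2, h3⟩ := M.pla_invariant hp0 hpm hp I
  have hused := M.plaState_used_le p I
  rw [toOnline_reward, h2]
  have hx0 := lowDemand_nonneg I
  have hpx := hpm _ hx0
  rcases h3 with ⟨h4, h5⟩ | ⟨h4, h5, -⟩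
  · left
    have : 0 ≤ min (lowDemand I) (M.m - p (lowDemand I)) := le_min hx0 (by linarith)
    refine ⟨by linarith, ?_⟩
    rw [h4, h5]
    ring
  · right
    rw [h4]
    have h6 : max (p (lowDemand I)) (M.m - lowDemand I) =
        M.m - min (lowDemand I) (M.m - p (lowDemand I)) := by
      simp only [min_def, max_def]
      split_ifs <;> linarith
    rw [h6]
    nlinarith [M.rl_lt_rh]

/-! ### The robustness bounds -/

variable (M : Market)

/-- The right side is the requirement at high-reward demand `m` when `m - p` units went to
low-reward requests. -/
lemma Market.gLow_le_iff {r p : ℝ} :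
    M.gLow r ≤ p ↔ r * (M.m * M.rh) ≤ p * M.rh + (M.m - p) * M.rl := by
  have h1 := M.rh_pos
  have h2 : 0 < 1 - M.rl / M.rh := sub_pos.2 ((div_lt_one h1).2 M.rl_lt_rh)
  unfold Market.gLow
  rw [div_le_iff₀ h2, ← mul_le_mul_iff_left₀ h1]
  have e1 : M.m * (r - M.rl / M.rh) * M.rh = M.m * (r * M.rh - M.rl) := by
    field_simp
  have e2 : p * (1 - M.rl / M.rh) * M.rh = p * (M.rh - M.rl) := by
    field_simp
  rw [e1, e2]
  constructor <;> intro h <;> linarith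

lemma Market.le_gUp_iff {r x p : ℝ} : p ≤ M.gUp r x ↔ r * min x M.m ≤ M.m - p := by
  unfold Market.gUp
  constructor <;> intro h <;> linarith

lemma Market.rho_mul : M.rho * (2 * M.rh - M.rl) = M.rh := by
  have h1 := M.rh_pos
  have h2 : 2 * M.rh - M.rl ≠ 0 := by linarith [M.rl_lt_rh]
  have h3 : 2 - M.rl / M.rh = (2 * M.rh - M.rl) / M.rh := by field_simp
  rw [Market.rho, h3]
  field_simp

lemma Market.rho_pos : 0 < M.rho := by
  have h1 := M.rh_pos
  have h2 : 0 < 2 * M.rh - M.rl := by linarith [M.rl_lt_rh]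
  by_contra! h
  nlinarith [M.rho_mul]

lemma Market.rho_lt_one : M.rho < 1 := by
  have h1 := M.rl_lt_rh
  have h2 := M.rho_mul
  have h3 := M.rh_pos
  by_contra! h
  nlinarith

lemma Market.gLow_mono {r r' : ℝ} (h : r ≤ r') : M.gLow r ≤ M.gLow r' := by
  have h1 := M.gLow_le_iff.1 (le_refl (M.gLow r'))
  refine M.gLow_le_iff.2 (le_trans ?_ h1)
  have := M.m_pos
  have := M.rh_pos
  gcongr

lemma Market.gUp_anti {r r' x : ℝ} (hx : 0 ≤ x) (h : r ≤ r') : M.gUp r' x ≤ M.gUp r x := by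
  have : 0 ≤ min x M.m := le_min hx M.m_pos.le
  unfold Market.gUp
  nlinarith

lemma Market.gUp_le_m {r x : ℝ} (hr : 0 ≤ r) (hx : 0 ≤ x) : M.gUp r x ≤ M.m := by
  have : 0 ≤ r * min x M.m := mul_nonneg hr (le_min hx M.m_pos.le)
  unfold Market.gUp
  linarith

lemma Market.gUp_anti_right {r x y : ℝ} (hr : 0 ≤ r) (h : x ≤ y) : M.gUp r y ≤ M.gUp r x := by
  have : r * min x M.m ≤ r * min y M.m := mul_le_mul_of_nonneg_left (min_le_min_right _ h) hr
  unfold Market.gUp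
  linarith

lemma Market.gUp_slope {r x y : ℝ} (hr : r ≤ 1) (h : x ≤ y) :
    M.gUp r x - (y - x) ≤ M.gUp r y := by
  have h1 : min y M.m - min x M.m ≤ y - x := by
    simp only [min_def]
    split_ifs <;> linarith
  have h2 : min x M.m ≤ min y M.m := min_le_min_right _ h
  unfold Market.gUp
  nlinarith

lemma Market.gUp_nonneg {r x : ℝ} (hr0 : 0 ≤ r) (hr : r ≤ 1) : 0 ≤ M.gUp r x := by
  have := M.m_pos
  have : min x M.m ≤ M.m := min_le_right _ _
  unfold Market.gUp
  nlinarith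

lemma Market.gUp_of_le {r x : ℝ} (hx : M.m ≤ x) : M.gUp r x = M.m - r * M.m := by
  rw [Market.gUp, min_eq_right hx]
  ring

/-- At ratio `ρ` the lower bound meets the upper bound beyond `m`, which is why no larger ratio is
possible (`Market.le_rho_of_gLow_le`). -/
lemma Market.gLow_rho : M.gLow M.rho = M.m - M.rho * M.m := by
  have h0 := M.rh_pos
  have h1 : 0 < M.rh - M.rl := sub_pos.2 M.rl_lt_rh
  have h2 : M.m * (M.rho - M.rl / M.rh) / (1 - M.rl / M.rh) =
      M.m * (M.rho * M.rh - M.rl) / (M.rh - M.rl) := by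
    field_simp
  rw [Market.gLow, h2, div_eq_iff h1.ne']
  linear_combination M.m * M.rho_mul

lemma Market.gLow_rho_le_gUp (x : ℝ) : M.gLow M.rho ≤ M.gUp M.rho x := by
  rw [M.gLow_rho, ← M.gUp_of_le (le_max_right x M.m)]
  exact M.gUp_anti_right M.rho_pos.le (le_max_left _ _)

lemma Market.gLow_rho_nonneg : 0 ≤ M.gLow M.rho := by
  rw [M.gLow_rho]
  nlinarith [M.rho_lt_one, M.m_pos]

lemma Market.le_rho_of_gLow_le {r : ℝ} (h : M.gLow r ≤ M.m - r * M.m) : r ≤ M.rho := by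
  have h1 := M.gLow_le_iff.1 h
  have h2 := M.rho_mul
  have h3 : 0 < 2 * M.rh - M.rl := by linarith [M.rl_lt_rh, M.rh_pos]
  have h4 : M.m * (r * (2 * M.rh - M.rl)) ≤ M.m * (M.rho * (2 * M.rh - M.rl)) := by
    rw [h2]
    linarith
  exact le_of_mul_le_mul_right (le_of_mul_le_mul_left h4 M.m_pos) h3

/-! ### Consistency and robustness of protection level algorithms -/

variable {M} {R : Set (ℝ × ℝ)} {C r : ℝ} {p : ℝ → ℝ}

/-- If all high-reward demand is served, `gUp` secures the fraction `r` of the low-reward part. If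
the resource is exhausted, `gLow` secures the fraction `r` of `m * rh`, the largest clairvoyant
reward. -/
lemma le_pla_robust (hp0 : ∀ x, 0 ≤ x → 0 ≤ p x)
    (hp : ∀ x y, 0 ≤ x → x ≤ y → p y ≤ p x ∧ p x - (y - x) ≤ p y)
    (hr0 : 0 ≤ r) (hr1 : r ≤ 1) (hg : ∀ x, 0 ≤ x → M.gLow r ≤ p x ∧ p x ≤ M.gUp r x) :
    r ≤ (M.pla p).toOnline.robust := by
  have hpm : ∀ x, 0 ≤ x → p x ≤ M.m := fun x hx => (hg x hx).2.trans (M.gUp_le_m hr0 hx)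
  refine OnlineAlg.le_robust _ fun I => ?_
  have hx0 := lowDemand_nonneg I
  have hy0 := highDemand_nonneg I
  have hrl := M.rl_pos
  have hrh := M.rh_pos
  refine M.le_ratio hx0 hy0 hr1 ?_
  rcases M.pla_reward hp0 hpm hp I with ⟨h1, h2⟩ | h
  · rw [h2]
    generalize lowDemand I = x at *
    generalize highDemand I = y at *
    have h3 := M.le_gUp_iff.1 (hg x hx0).2
    have h4 : 0 ≤ min x M.m := le_min hx0 M.m_pos.le
    have h5 : r * min x M.m ≤ min x (M.m - p x) :=
      le_min ((mul_le_of_le_one_left h4 hr1).trans (min_le_left _ _)) h3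
    have h6 : min x (max (M.m - y) 0) ≤ min x M.m :=
      min_le_min_left _ (max_le (by linarith) M.m_pos.le)
    have h7 : r * min x (max (M.m - y) 0) ≤ r * min x M.m := mul_le_mul_of_nonneg_left h6 hr0
    have h8 : r * y ≤ y := mul_le_of_le_one_left hy0 hr1
    unfold Market.opt
    rw [min_eq_left h1]
    nlinarith
  · refine le_trans ?_ h
    generalize lowDemand I = x at *
    have h3 := M.gLow_le_iff.1 (hg x hx0).1
    have h4 : max (p x) (M.m - x) * M.rh + min x (M.m - p x) * M.rl ≥
        p x * M.rh + (M.m - p x) * M.rl := by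
      have h6 : max (p x) (M.m - x) = M.m - min x (M.m - p x) := by
        simp only [min_def, max_def]
        split_ifs <;> linarith
      have h7 : min x (M.m - p x) ≤ M.m - p x := min_le_right _ _
      rw [h6]
      nlinarith [M.rl_lt_rh]
    exact (mul_le_mul_of_nonneg_left (M.opt_le hx0 _) hr0).trans (h3.trans h4)

lemma le_pla_consis (hne : R.Nonempty) (hnonneg : ∀ z ∈ R, 0 ≤ z.1 ∧ 0 ≤ z.2)
    (hC0 : 0 ≤ C) (hC1 : C ≤ 1) (hp0 : ∀ x, 0 ≤ x → 0 ≤ p x) (hpm : ∀ x, 0 ≤ x → p x ≤ M.m)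
    (hp : ∀ x y, 0 ≤ x → x ≤ y → p y ≤ p x ∧ p x - (y - x) ≤ p y)
    (hb : ∀ x ∈ proj R, M.lTilde R C x ≤ p x ∧ p x ≤ M.u R C x) :
    C ≤ (M.pla p).toOnline.consis R := by
  refine OnlineAlg.le_consis _ hne hnonneg fun I hI => ?_
  have hx0 := lowDemand_nonneg I
  have hproj : lowDemand I ∈ proj R := ⟨_, hI, rfl⟩
  obtain ⟨hl, hu⟩ := hb _ hproj
  refine M.le_ratio hx0 (highDemand_nonneg I) hC1 ?_
  rcases M.pla_reward hp0 hpm hp I with ⟨h1, h2⟩ | h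
  · rw [h2]
    exact mul_opt_le_of_le_uPt hnonneg hC0 hC1 (hu.trans (u_le_uPt hproj le_rfl)) hI h1
  · exact (mul_opt_le_of_lPt_le hnonneg hC0 hC1
      (((lPt_le_l hproj le_rfl).trans (l_le_lTilde hx0)).trans hl) hI).trans h

end

section

/-! ### Feasible solutions of the optimization problems -/

variable {M : Market} {R : Set (ℝ × ℝ)} {C r v : ℝ} {p : ℝ → ℝ}

lemma xmin_le_xmax (hne : R.Nonempty) (hnonneg : ∀ z ∈ R, 0 ≤ z.1 ∧ 0 ≤ z.2)
    (hbdd : BddAbove (proj R)) : xmin R ≤ xmax R := by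
  obtain ⟨z, hz⟩ := hne
  have hx : z.1 ∈ proj R := ⟨z, hz, rfl⟩
  exact (xmin_le hnonneg hx).trans (le_csSup hbdd hx)

lemma Market.gLow_le_gUp (M : Market) {r x : ℝ} (hr : r ≤ M.rho) (hx : 0 ≤ x) :
    M.gLow r ≤ M.gUp r x :=
  (M.gLow_mono hr).trans ((M.gLow_rho_le_gUp x).trans (M.gUp_anti hx hr))

lemma ValidOn.max_const {a b : ℝ} (ha : 0 ≤ a) (v : ℝ) :
    ValidOn (fun x => max (M.lTilde R C x) v) a b := by
  refine ⟨fun x _ => lTilde_nonneg.trans (le_max_left _ _), fun x hx y hy hxy => ⟨?_, ?_⟩⟩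
  · exact max_le_max_right _ (lTilde_anti (ha.trans hx.1) hxy)
  · have h1 := lTilde_slope (M := M) (R := R) (C := C) hxy
    have h2 := le_max_left (M.lTilde R C y) v
    have h3 := le_max_right (M.lTilde R C y) v
    have h4 : max (M.lTilde R C x) v ≤ max (M.lTilde R C y) v + (y - x) :=
      max_le (by linarith) (by linarith)
    linarith

/-- Every feasible function lies above `lTilde` and `gLow r`, so their maximum is the least
candidate and only upper bounds need checking; `u` is smallest at `xmax R`. -/
lemma transFeasible_max (hlu : ∀ x, M.lTilde R C x ≤ M.u R C x) (hr : r ∈ Set.Icc 0 M.rho)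
    (hu : M.gLow r ≤ M.u R C (xmax R)) (hl : ∀ x, 0 ≤ x → M.lTilde R C x ≤ M.gUp r x) :
    M.TransFeasible R C r (fun x => max (M.lTilde R C x) (M.gLow r)) :=
  ⟨hr, fun x hx => ⟨le_max_left _ _, max_le (hlu x) (hu.trans (u_antitone hx.2))⟩,
    fun x hx => ⟨le_max_right _ _, max_le (hl x hx.1) (M.gLow_le_gUp hr.2 hx.1)⟩,
    ValidOn.max_const le_rfl _⟩

/-- Monotonicity keeps every feasible function above its end value `v`; this is again the least
candidate. -/
lemma leftFeasible_max (hlu : ∀ x, M.lTilde R C x ≤ M.u R C x) (hr : r ∈ Set.Icc 0 M.rho)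
    (hlv : M.lTilde R C (xmax R) ≤ v) (hvu : v ≤ M.u R C (xmax R)) (hgv : M.gLow r ≤ v)
    (hvg : v ≤ M.gUp r (xmax R))
    (hl : ∀ x ∈ Set.Icc 0 (xmax R), M.lTilde R C x ≤ M.gUp r x) :
    M.LeftFeasible R C v r (fun x => max (M.lTilde R C x) v) :=
  ⟨hr, fun x hx => ⟨le_max_left _ _, max_le (hlu x) (hvu.trans (u_antitone hx.2))⟩,
    fun x hx => ⟨hgv.trans (le_max_right _ _),
      max_le (hl x hx) (hvg.trans (M.gUp_anti_right hr.1 hx.2))⟩,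
    ValidOn.max_const le_rfl _, max_eq_right hlv⟩

/-- The left problem imposes this bound only from `xmin R` on. Further left it is automatic, since
`p` is non-increasing and `lTilde` never exceeds its value at `xmin R`. -/
lemma Market.LeftFeasible.lTilde_le (h : M.LeftFeasible R C v r p)
    (hnonneg : ∀ z ∈ R, 0 ≤ z.1 ∧ 0 ≤ z.2) (hmm : xmin R ≤ xmax R) {x : ℝ}
    (hx : x ∈ Set.Icc 0 (xmax R)) : M.lTilde R C x ≤ p x := by
  obtain ⟨-, h1, -, ⟨-, h2⟩, -⟩ := h
  rcases le_total (xmin R) x with h | h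
  · exact (h1 x ⟨h, hx.2⟩).1
  · exact (lTilde_le_xmin hnonneg x).trans ((h1 _ ⟨le_rfl, hmm⟩).1.trans
      (h2 x hx _ ⟨xmin_nonneg hnonneg, hmm⟩ h).1)

lemma Market.LeftFeasible.le_u (h : M.LeftFeasible R C v r p)
    (hnonneg : ∀ z ∈ R, 0 ≤ z.1 ∧ 0 ≤ z.2) {x : ℝ}
    (hx : x ∈ Set.Icc 0 (xmax R)) : p x ≤ M.u R C x := by
  obtain ⟨hr, h1, h3, -, -⟩ := h
  rcases le_or_gt (xmin R) x with h | h
  · exact (h1 x ⟨h, hx.2⟩).2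
  · rw [u_eq_of_lt_xmin hnonneg h]
    exact (h3 x hx).2.trans (M.gUp_le_m hr.1 hx.1)

/-- The robust ratio of every algorithm with consistent ratio at least `C` is attained in the
transformed problem. -/
lemma OnlineAlg.exists_transFeasible (A : OnlineAlg M) (hne : R.Nonempty)
    (hnonneg : ∀ z ∈ R, 0 ≤ z.1 ∧ 0 ≤ z.2) (hC : C ≤ A.consis R) :
    ∃ p, M.TransFeasible R C A.robust p := by
  -- Robustness is treated as consistency with the whole quadrant.
  set Q : Set (ℝ × ℝ) := {z | 0 ≤ z.1 ∧ 0 ≤ z.2}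
  have hA : ∀ I, (lowDemand I, highDemand I) ∈ R → C ≤ A.perf I := fun I hI =>
    hC.trans (A.consis_le_perf hI)
  have hQ : ∀ I, (lowDemand I, highDemand I) ∈ Q → A.robust ≤ A.perf I := fun I _ =>
    A.robust_le_perf I
  have hC1 : C ≤ 1 := A.le_one hne hnonneg hA
  have hr0 := A.robust_nonneg
  have hr1 : A.robust ≤ 1 := A.le_one (R := Q) ⟨(0, 0), le_rfl, le_rfl⟩ (fun z hz => hz) hQ
  have key : ∀ s t, 0 ≤ s → s ≤ t → ∃ p q, M.Compat R C s p ∧ M.Compat R C t q ∧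
      (M.gLow A.robust ≤ p ∧ p ≤ M.gUp A.robust s) ∧
      (M.gLow A.robust ≤ q ∧ q ≤ M.gUp A.robust t) ∧ q ≤ p ∧ p ≤ q + (t - s) := by
    have hg : ∀ x p, 0 ≤ x → M.Compat Q A.robust x p →
        M.gLow A.robust ≤ p ∧ p ≤ M.gUp A.robust x := by
      rintro x p hx ⟨hp, -, h⟩
      constructor
      -- High-reward demand `m` yields `gLow`; below, demand `0` yields `gUp`.
      · have h1 := h M.m M.m_pos.le ⟨hx, M.m_pos.le⟩
        rw [M.opt_top hx, min_eq_right hp.2] at h1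
        exact M.gLow_le_iff.2 h1
      · have h1 := h 0 le_rfl ⟨hx, le_rfl⟩
        rw [M.opt_zero, min_eq_left hp.1, zero_mul, zero_add, ← mul_assoc] at h1
        exact M.le_gUp_iff.2 (le_of_mul_le_mul_right h1 M.rl_pos)
    intro s t hs hst
    obtain ⟨p, q, h1, h2, h⟩ := A.exists_levels hs hst
    exact ⟨p, q, (h R C hA).1, (h R C hA).2, hg s p hs (h Q _ hQ).1,
      hg t q (hs.trans hst) (h Q _ hQ).2, h1, h2⟩
  refine ⟨_, transFeasible_max (lTilde_le_u hnonneg hC1 fun s t hs hst => ?_) ⟨hr0, ?_⟩ ?_ ?_⟩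
  · obtain ⟨p, q, hp, hq, -, -, h1, h2⟩ := key s t hs hst
    exact ⟨p, q, hp, hq, h1, h2⟩
  · obtain ⟨p, -, -, -, hp, -⟩ := key M.m M.m M.m_pos.le le_rfl
    have := hp.1.trans hp.2
    rw [M.gUp_of_le le_rfl] at this
    exact M.le_rho_of_gLow_le this
  · refine RobustAlloc.le_u ?_ fun t ht _ => ?_
    · obtain ⟨p, -, h, -, hp, -⟩ := key 0 0 le_rfl le_rfl
      exact hp.1.trans h.1.2
    · obtain ⟨p, -, h, -, hp, -⟩ := key t t (proj_nonneg hnonneg ht) le_rfl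
      exact hp.1.trans (h.le_uPt hnonneg ht hC1)
  · refine fun x hx => lTilde_le_of_lPt_le (M.gUp_nonneg hr0 hr1) fun t ht => ?_
    rcases le_total x t with hxt | htx
    · obtain ⟨p, q, -, hq, hp, -, h1, -⟩ := key x t hx hxt
      linarith [hq.lPt_le hnonneg ht hC1, hp.2, le_max_right (x - t) 0]
    · obtain ⟨p, q, hp, -, -, hq, -, h2⟩ := key t x (proj_nonneg hnonneg ht) htx
      linarith [hp.lPt_le hnonneg ht hC1, hq.2, le_max_left (x - t) 0]

/-! ### Gluing the solutions of the left and the right problem -/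

lemma glue_of_le {pl pr : ℝ → ℝ} {x : ℝ} (h : x ≤ xmax R) : M.glue R pl pr x = pl x := if_pos h

lemma glue_of_ge {pl pr : ℝ → ℝ} {x : ℝ} (hv : pl (xmax R) = pr (xmax R)) (h : xmax R ≤ x) :
    M.glue R pl pr x = pr (min x (M.xend R)) := by
  have hXE : xmax R ≤ M.xend R := le_max_right _ _
  rcases h.eq_or_lt with rfl | h
  · rw [glue_of_le le_rfl, hv, min_eq_left hXE]
  · exact if_neg (not_le.2 h)

lemma glue_valid {pl pr : ℝ → ℝ} (hpl : ValidOn pl 0 (xmax R))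
    (hpr : ValidOn pr (xmax R) (M.xend R))
    (hv : pl (xmax R) = pr (xmax R)) {x y : ℝ} (hx : 0 ≤ x) (hxy : x ≤ y) :
    M.glue R pl pr y ≤ M.glue R pl pr x ∧
      M.glue R pl pr x - (y - x) ≤ M.glue R pl pr y := by
  have hXE : xmax R ≤ M.xend R := le_max_right _ _
  have hleft : ∀ x y, 0 ≤ x → x ≤ y → y ≤ xmax R → M.glue R pl pr y ≤ M.glue R pl pr x ∧
      M.glue R pl pr x - (y - x) ≤ M.glue R pl pr y := fun x y hx hxy hy => by
    rw [glue_of_le hy, glue_of_le (hxy.trans hy)]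
    exact hpl.2 x ⟨hx, hxy.trans hy⟩ y ⟨hx.trans hxy, hy⟩ hxy
  have hright : ∀ x y, xmax R ≤ x → x ≤ y → M.glue R pl pr y ≤ M.glue R pl pr x ∧
      M.glue R pl pr x - (y - x) ≤ M.glue R pl pr y := fun x y hx hxy => by
    rw [glue_of_ge hv hx, glue_of_ge hv (hx.trans hxy)]
    have h := hpr.2 (min x (M.xend R)) ⟨le_min hx hXE, min_le_right _ _⟩ (min y (M.xend R))
      ⟨le_min (hx.trans hxy) hXE, min_le_right _ _⟩ (min_le_min_right _ hxy)
    have h1 : min y (M.xend R) - min x (M.xend R) ≤ y - x := by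
      simp only [min_def]
      split_ifs <;> linarith
    exact ⟨h.1, by linarith [h.2]⟩
  rcases le_total y (xmax R) with hy | hy
  · exact hleft x y hx hxy hy
  · rcases le_total x (xmax R) with hx' | hx'
    · have h1 := hleft x _ hx hx' le_rfl
      have h2 := hright _ y le_rfl hy
      exact ⟨h2.1.trans h1.1, by linarith [h1.2, h2.2]⟩
    · exact hright x y hx' hxy

lemma glue_bounds {rRight rLeft : ℝ} {pl pr : ℝ → ℝ}
    (hpr : M.RightFeasible R C rRight pr)
    (hpl : M.LeftFeasible R C (pr (xmax R)) rLeft pl) {x : ℝ} (hx : 0 ≤ x) :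
    M.gLow (min rRight rLeft) ≤ M.glue R pl pr x ∧
      M.glue R pl pr x ≤ M.gUp (min rRight rLeft) x ∧ 0 ≤ M.glue R pl pr x := by
  obtain ⟨-, -, h1, h2⟩ := hpr
  obtain ⟨-, -, h3, h4, hv⟩ := hpl
  rcases le_total x (xmax R) with h | h
  · rw [glue_of_le h]
    exact ⟨(M.gLow_mono (min_le_right _ _)).trans (h3 x ⟨hx, h⟩).1,
      (h3 x ⟨hx, h⟩).2.trans (M.gUp_anti hx (min_le_right _ _)), h4.1 x ⟨hx, h⟩⟩
  · rw [glue_of_ge hv h]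
    have hmem : min x (M.xend R) ∈ Set.Icc (xmax R) (M.xend R) :=
      ⟨le_min h (le_max_right _ _), min_le_right _ _⟩
    refine ⟨(M.gLow_mono (min_le_left _ _)).trans (h1 _ hmem).1,
      (h1 _ hmem).2.trans (le_trans (le_of_eq ?_) (M.gUp_anti hx (min_le_left _ _))),
      h2.1 _ hmem⟩
    -- Beyond `xend ≥ m` both the glued function and `gUp` are constant.
    unfold Market.gUp
    have hE : M.m ≤ M.xend R := le_max_left _ _
    rw [min_assoc, min_eq_right hE]

lemma glue_isOptimal (hne : R.Nonempty) (hnonneg : ∀ z ∈ R, 0 ≤ z.1 ∧ 0 ≤ z.2)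
    (hbdd : BddAbove (proj R)) (hlu : ∀ x, M.lTilde R C x ≤ M.u R C x) {rRight rLeft : ℝ}
    {pl pr : ℝ → ℝ} (hpr : IsOptimal (M.RightFeasible R C) rRight pr)
    (hpl : IsOptimal (M.LeftFeasible R C (pr (xmax R))) rLeft pl) :
    IsOptimal (M.TransFeasible R C) (min rRight rLeft) (M.glue R pl pr) := by
  have hmm := xmin_le_xmax hne hnonneg hbdd
  have hmin0 := xmin_nonneg hnonneg
  have hX : 0 ≤ xmax R := hmin0.trans hmm
  have hXE : xmax R ≤ M.xend R := le_max_right _ _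
  have hv : pl (xmax R) = pr (xmax R) := hpl.1.2.2.2.2
  refine ⟨⟨⟨le_min hpr.1.1.1 hpl.1.1.1, (min_le_left _ _).trans hpr.1.1.2⟩, fun x hx => ?_,
    fun x hx => ?_, fun x hx => ?_, fun x hx y hy hxy => ?_⟩, fun r' p' h => ?_⟩
  · rw [glue_of_le hx.2]
    exact ⟨hpl.1.lTilde_le hnonneg hmm hx, hpl.1.le_u hnonneg hx⟩
  · have := glue_bounds hpr.1 hpl.1 hx.1
    exact ⟨this.1, this.2.1⟩
  · exact (glue_bounds hpr.1 hpl.1 hx.1).2.2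
  · exact glue_valid hpl.1.2.2.2.1 hpr.1.2.2.2 hv hx.1 hxy
  · obtain ⟨hr', hb, hg, hval⟩ := h
    have hright : r' ≤ rRight := hpr.2 r' p' ⟨hr', hb _ ⟨hX, le_rfl⟩,
      fun x hx => hg x ⟨hX.trans hx.1, hx.2⟩,
      fun x hx => hval.1 x ⟨hX.trans hx.1, hx.2⟩,
      fun x hx y hy => hval.2 x ⟨hX.trans hx.1, hx.2⟩ y ⟨hX.trans hy.1, hy.2⟩⟩
    -- Since `r' ≤ rRight`, the prescribed end value meets the robustness bounds at `r'`; the bound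
    -- on `lTilde` comes from `p'`.
    refine le_min hright (hpl.2 r' _ (leftFeasible_max hlu hr' hpr.1.2.1.1 hpr.1.2.1.2
      ?_ ?_ fun x hx => (hb x hx).1.trans (hg x ⟨hx.1, hx.2.trans hXE⟩).2))
    · exact (M.gLow_mono hright).trans (hpr.1.2.2.1 _ ⟨le_rfl, hXE⟩).1
    · exact (hpr.1.2.2.1 _ ⟨le_rfl, hXE⟩).2.trans (M.gUp_anti hX hright)

end

section

/-! ### The explicit solutions -/

lemma Market.le_CPo_iff (M : Market) {r p x : ℝ} (hr1 : r ≤ 1) (hpm : p ≤ M.m)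
    (hx : 0 ≤ x) : r ≤ M.CPo p x 0 ↔ p ≤ M.gUp r x := by
  have h0 : 0 ≤ min x M.m := le_min hx M.m_pos.le
  have h1 : r * min x M.m ≤ x := (mul_le_of_le_one_left h0 hr1).trans (min_le_left _ _)
  have h2 : 0 ≤ min x (M.m - p) := le_min hx (by linarith)
  have hrl := M.rl_pos
  rw [M.le_gUp_iff]
  have hnum : min 0 M.m * M.rh + min x (max (M.m - p) 0) * M.rl = min x (M.m - p) * M.rl := by
    rw [min_eq_left M.m_pos.le, max_eq_left (by linarith)]
    ring
  unfold Market.CPo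
  rw [hnum]
  constructor
  · intro h
    have h3 := M.mul_opt_le hx le_rfl (by positivity) h
    rw [M.opt_zero, ← mul_assoc] at h3
    exact (le_of_mul_le_mul_right h3 hrl).trans (min_le_right _ _)
  · intro h
    refine M.le_ratio hx le_rfl hr1 ?_
    rw [M.opt_zero, ← mul_assoc]
    exact mul_le_mul_of_nonneg_right (le_min h1 h) hrl.le

lemma Market.CPu_top (M : Market) {p x : ℝ} (hp0 : 0 ≤ p) (hx : M.m ≤ x) :
    M.CPu p x M.m = (p * M.rh + (M.m - p) * M.rl) / (M.m * M.rh) := by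
  have hm := M.m_pos
  have hrh := M.rh_pos
  unfold Market.CPu Market.ratio
  rw [M.opt_top (hm.le.trans hx), if_neg (by positivity), max_eq_right (by linarith : M.m - x ≤ 0),
    min_eq_right hm.le, max_eq_left hp0, min_eq_right (by linarith)]

lemma Market.le_CPu_iff (M : Market) {r p x : ℝ} (hp0 : 0 ≤ p) (hx : M.m ≤ x) :
    r ≤ M.CPu p x M.m ↔ M.gLow r ≤ p := by
  rw [M.CPu_top hp0 hx, M.gLow_le_iff, le_div_iff₀ (mul_pos M.m_pos M.rh_pos)]

lemma Market.gLow_CPu (M : Market) {p x : ℝ} (hp0 : 0 ≤ p) (hx : M.m ≤ x) :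
    M.gLow (M.CPu p x M.m) = p := by
  have hm := M.m_pos
  have hrh := M.rh_pos
  have h1 : 0 < M.rh - M.rl := sub_pos.2 M.rl_lt_rh
  rw [M.CPu_top hp0 hx]
  unfold Market.gLow
  field_simp
  ring

lemma Market.CPu_gLow_rho (M : Market) {x : ℝ} (hx : M.m ≤ x) :
    M.CPu (M.gLow M.rho) x M.m = M.rho := by
  rw [M.CPu_top M.gLow_rho_nonneg hx, M.gLow_rho,
    div_eq_iff (mul_pos M.m_pos M.rh_pos).ne']
  linear_combination -M.m * M.rho_mul

lemma Market.CPu_nonneg (M : Market) {p x : ℝ} (hp0 : 0 ≤ p) (hpm : p ≤ M.m) (hx : M.m ≤ x) :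
    0 ≤ M.CPu p x M.m := by
  rw [M.le_CPu_iff hp0 hx, M.gLow_le_iff, zero_mul]
  have := M.rl_pos
  have := M.rh_pos
  have : 0 ≤ M.m - p := by linarith
  positivity

/-- The hypothesis `gUp 1 x ≤ p` gives `m - p ≤ x`, so the low-reward amount is not truncated by
demand and the ratio can be inverted. -/
lemma Market.gUp_CPo (M : Market) {p x : ℝ} (hpm : p ≤ M.m) (hx : 0 < x)
    (h : M.gUp 1 x ≤ p) : M.gUp (M.CPo p x 0) x = p := by
  have hpos : 0 < min x M.m := lt_min hx M.m_pos
  have hrl := M.rl_pos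
  have h1 : M.m - p ≤ x := by
    have : min x M.m ≤ x := min_le_left _ _
    unfold Market.gUp at h
    linarith
  unfold Market.gUp Market.CPo Market.ratio
  rw [M.opt_zero, if_neg (by positivity), min_eq_left M.m_pos.le, max_eq_left (by linarith),
    min_eq_right h1]
  field_simp
  ring

variable {M : Market} {R : Set (ℝ × ℝ)} {C : ℝ}

lemma lTilde_le_pBar : M.lTilde R C (xmax R) ≤ M.pBar R C := le_max_left _ _

lemma pBar_le_u (h : M.lTilde R C (xmax R) ≤ M.u R C (xmax R)) :
    M.pBar R C ≤ M.u R C (xmax R) := max_le h (min_le_left _ _)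

lemma pBar_eq_u (h : M.lTilde R C (xmax R) ≤ M.u R C (xmax R))
    (h1 : M.pBar R C < M.gLow M.rho) : M.pBar R C = M.u R C (xmax R) := by
  unfold Market.pBar at *
  have h2 := (le_max_right _ _).trans_lt h1
  rw [min_eq_left_of_lt ((min_lt_iff.1 h2).resolve_right (lt_irrefl _)), max_eq_right h]

lemma pBar_eq_lTilde (h1 : M.gLow M.rho < M.pBar R C) :
    M.pBar R C = M.lTilde R C (xmax R) := by
  unfold Market.pBar at *
  have h2 : min (M.u R C (xmax R)) (M.gLow M.rho) ≤ M.gLow M.rho := min_le_right _ _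
  exact max_eq_left (h2.trans ((lt_max_iff.1 h1).resolve_right (not_lt.2 h2)).le)

lemma pBar_nonneg : 0 ≤ M.pBar R C := lTilde_nonneg.trans lTilde_le_pBar

lemma pBar_le_m (h : M.lTilde R C (xmax R) ≤ M.u R C (xmax R)) : M.pBar R C ≤ M.m :=
  (pBar_le_u h).trans u_le_m

lemma pRight_xmax : M.pRight R C (xmax R) = M.pBar R C := if_pos le_rfl

lemma pRight_isOptimal (hX : 0 ≤ xmax R) (hlu : M.lTilde R C (xmax R) ≤ M.u R C (xmax R)) :
    IsOptimal (M.RightFeasible R C) (M.rRight R C) (M.pRight R C) := by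
  have hE : M.m ≤ M.xend R := le_max_left _ _
  have hXE : xmax R ≤ M.xend R := le_max_right _ _
  have hb0 : 0 ≤ M.pBar R C := pBar_nonneg
  have hbm := pBar_le_m hlu
  have hρ0 := M.rho_pos.le
  have hρ1 := M.rho_lt_one.le
  have hbounds : M.lTilde R C (xmax R) ≤ M.pRight R C (xmax R) ∧
      M.pRight R C (xmax R) ≤ M.u R C (xmax R) := by
    rw [pRight_xmax]
    exact ⟨lTilde_le_pBar, pBar_le_u hlu⟩
  rcases lt_or_ge (M.pBar R C) (M.gLow M.rho) with h1 | h1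
  · -- the protection level is forced below `gLow ρ`
    have hup : M.pBar R C ≤ M.gUp M.rho (xmax R) := h1.le.trans (M.gLow_rho_le_gUp _)
    have hlt : M.CPu (M.pBar R C) (M.xend R) M.m < M.rho := by
      rw [← not_le, M.le_CPu_iff hb0 hE]
      exact not_le.2 h1
    have hrB : M.rBar R C = M.CPu (M.pBar R C) (M.xend R) M.m :=
      min_eq_right (hlt.le.trans ((M.le_CPo_iff hρ1 hbm hX).2 hup))
    have hg : M.gLow (M.rBar R C) = M.pBar R C := by rw [hrB, M.gLow_CPu hb0 hE]
    have hp : ∀ x, M.pRight R C x = M.pBar R C := fun x => by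
      unfold Market.pRight
      rw [if_pos h1, hg, ite_self]
    have hr : M.rRight R C = M.rBar R C := by
      unfold Market.rRight
      rw [hp, hp]
      rfl
    have hr0 : 0 ≤ M.rBar R C := hrB ▸ M.CPu_nonneg hb0 hbm hE
    have hrρ : M.rBar R C ≤ M.rho := hrB ▸ hlt.le
    rw [hr]
    refine ⟨⟨⟨hr0, hrρ⟩, hbounds, fun x hx => ?_, fun x _ => ?_, fun x _ y _ hxy => ?_⟩,
      fun r' p' h => ?_⟩
    · rw [hp, hg]
      exact ⟨le_rfl, h1.le.trans ((M.gLow_rho_le_gUp x).trans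
        (M.gUp_anti (hX.trans hx.1) hrρ))⟩
    · rw [hp]
      exact hb0
    · rw [hp, hp]
      exact ⟨le_rfl, by linarith⟩
    -- Optimality is decided at `xmax R` alone: `gLow r'` lies below `p'`, hence below `u`, which
    -- equals `pBar`.
    · rw [hrB, M.le_CPu_iff hb0 hE, pBar_eq_u hlu h1]
      exact (h.2.2.1 _ ⟨le_rfl, hXE⟩).1.trans h.2.1.2
  rcases lt_or_ge (M.gUp M.rho (xmax R)) (M.pBar R C) with h2 | h2
  · -- the protection level is forced above `gUp ρ`
    have hlt : M.CPo (M.pBar R C) (xmax R) 0 < M.rho := by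
      rw [← not_le, M.le_CPo_iff hρ1 hbm hX]
      exact not_le.2 h2
    have hrB : M.rBar R C = M.CPo (M.pBar R C) (xmax R) 0 :=
      min_eq_left (hlt.le.trans ((M.le_CPu_iff hb0 hE).2 h1))
    have hr0 : 0 ≤ M.rBar R C := hrB ▸ (M.le_CPo_iff zero_le_one hbm hX).2
      (by simpa [Market.gUp] using hbm)
    have hrρ : M.rBar R C ≤ M.rho := hrB ▸ hlt.le
    have hXpos : 0 < xmax R := by
      refine hX.lt_of_ne fun h0 => ?_
      rw [← h0, Market.gUp, min_eq_left M.m_pos.le] at h2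
      linarith
    have hg : M.gUp (M.rBar R C) (xmax R) = M.pBar R C := by
      rw [hrB, M.gUp_CPo hbm hXpos ((M.gUp_anti hX hρ1).trans h2.le)]
    have hp : ∀ x, xmax R ≤ x → M.pRight R C x = M.gUp (M.rBar R C) x := fun x hx => by
      rcases hx.eq_or_lt with rfl | hx
      · rw [pRight_xmax, hg]
      · unfold Market.pRight
        rw [if_neg (not_le.2 hx), if_neg (not_lt.2 h1), if_pos h2]
    have hup : ∀ x, xmax R ≤ x → M.gLow M.rho ≤ M.gUp (M.rBar R C) x := fun x hx =>
      (M.gLow_rho_le_gUp x).trans (M.gUp_anti (hX.trans hx) hrρ)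
    have hr : M.rRight R C = M.rBar R C := by
      unfold Market.rRight
      rw [pRight_xmax, ← hrB]
      refine min_eq_left (hrρ.trans ?_)
      rw [hp _ hXE, M.le_CPu_iff (M.gUp_nonneg hr0 (hrρ.trans hρ1)) hE]
      exact hup _ hXE
    rw [hr]
    refine ⟨⟨⟨hr0, hrρ⟩, hbounds, fun x hx => ?_, fun x hx => ?_, fun x hx y hy hxy => ?_⟩,
      fun r' p' h => ?_⟩
    · rw [hp x hx.1]
      exact ⟨(M.gLow_mono hrρ).trans (hup x hx.1), le_rfl⟩
    · rw [hp x hx.1]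
      exact M.gUp_nonneg hr0 (hrρ.trans hρ1)
    · rw [hp x hx.1, hp y hy.1]
      exact ⟨M.gUp_anti_right hr0 hxy, M.gUp_slope (hrρ.trans hρ1) hxy⟩
    · rw [hrB, M.le_CPo_iff (h.1.2.trans hρ1) hbm hX,
        pBar_eq_lTilde ((M.gLow_rho_le_gUp _).trans_lt h2)]
      exact h.2.1.1.trans (h.2.2.1 _ ⟨le_rfl, hXE⟩).2
  · -- the optimal robust ratio `ρ` is attained
    have hp : ∀ x, xmax R ≤ x →
        M.pRight R C x = max (-x + xmax R + M.pBar R C) (M.gLow M.rho) := fun x hx => by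
      rcases hx.eq_or_lt with rfl | hx
      · rw [pRight_xmax, neg_add_cancel, zero_add, max_eq_left h1]
      · unfold Market.pRight
        rw [if_neg (not_le.2 hx), if_neg (not_lt.2 h1), if_neg (not_lt.2 h2)]
    have hup : ∀ x, xmax R ≤ x → M.pRight R C x ≤ M.gUp M.rho x := fun x hx => by
      rw [hp x hx]
      exact max_le (by linarith [M.gUp_slope hρ1 hx]) (M.gLow_rho_le_gUp x)
    have hlow : ∀ x, xmax R ≤ x → M.gLow M.rho ≤ M.pRight R C x := fun x hx => by
      rw [hp x hx]
      exact le_max_right _ _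
    -- Since `xend ≥ m`, the two bounds for ratio `ρ` coincide there.
    have hend : M.pRight R C (M.xend R) = M.gLow M.rho := by
      refine le_antisymm ?_ (hlow _ hXE)
      have := hup _ hXE
      rwa [M.gUp_of_le hE, ← M.gLow_rho] at this
    have hr : M.rRight R C = M.rho := by
      unfold Market.rRight
      rw [pRight_xmax, hend, M.CPu_gLow_rho hE]
      exact min_eq_right ((M.le_CPo_iff hρ1 hbm hX).2 h2)
    rw [hr]
    refine ⟨⟨⟨hρ0, le_rfl⟩, hbounds, fun x hx => ⟨hlow x hx.1, hup x hx.1⟩, fun x hx => ?_,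
      fun x hx y hy hxy => ?_⟩, fun r' p' h => h.1.2⟩
    · exact M.gLow_rho_nonneg.trans (hlow x hx.1)
    · rw [hp x hx.1, hp y hy.1]
      refine ⟨max_le_max_right _ (by linarith), ?_⟩
      have h3 := le_max_left (-y + xmax R + M.pBar R C) (M.gLow M.rho)
      have h4 := le_max_right (-y + xmax R + M.pBar R C) (M.gLow M.rho)
      have h5 : max (-x + xmax R + M.pBar R C) (M.gLow M.rho) ≤
          max (-y + xmax R + M.pBar R C) (M.gLow M.rho) + (y - x) :=
        max_le (by linarith) (by linarith)
      linarith

lemma exists_pLeft_isOptimal (hne : R.Nonempty) (hnonneg : ∀ z ∈ R, 0 ≤ z.1 ∧ 0 ≤ z.2)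
    (hbdd : BddAbove (proj R)) (hlu : ∀ x, M.lTilde R C x ≤ M.u R C x) :
    ∃ rLeft, IsOptimal (M.LeftFeasible R C (M.pRight R C (xmax R))) rLeft (M.pLeft R C) ∧
      M.rStar R C = min (M.rRight R C) rLeft := by
  have hmm := xmin_le_xmax hne hnonneg hbdd
  have hmin0 := xmin_nonneg hnonneg
  have hX : 0 ≤ xmax R := hmin0.trans hmm
  have hE : M.m ≤ M.xend R := le_max_left _ _
  have hXE : xmax R ≤ M.xend R := le_max_right _ _
  have hb0 : 0 ≤ M.pBar R C := pBar_nonneg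
  have hbm := pBar_le_m (hlu (xmax R))
  have hρ0 := M.rho_pos.le
  have hρ1 := M.rho_lt_one.le
  have hpm : ∀ x, M.pLeft R C x ≤ M.m := fun x => max_le lTilde_le_m hbm
  set S := (fun x => M.CPo (M.pLeft R C x) x 0) '' Set.Icc 0 (xmax R) with hS
  have hle : ∀ r ≤ 1,
      (r ≤ sInf S ↔ ∀ x ∈ Set.Icc 0 (xmax R), M.pLeft R C x ≤ M.gUp r x) := by
    intro r hr1
    have hbelow : BddBelow S := by
      refine ⟨0, ?_⟩
      rintro _ ⟨x, hx, rfl⟩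
      exact (M.le_CPo_iff zero_le_one (hpm x) hx.1).2 (by simpa [Market.gUp] using hpm x)
    rw [le_csInf_iff hbelow ((Set.nonempty_Icc.2 hX).image _), hS, Set.forall_mem_image]
    exact forall₂_congr fun x hx => M.le_CPo_iff hr1 (hpm x) hx.1
  set c := M.CPu (M.pBar R C) (M.xend R) M.m with hc
  have hc0 : 0 ≤ c := M.CPu_nonneg hb0 hbm hE
  have hS0 : 0 ≤ sInf S := (hle 0 zero_le_one).2 fun x _ => by
    simpa [Market.gUp] using hpm x
  have hrmem : min (min M.rho c) (sInf S) ∈ Set.Icc 0 M.rho :=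
    ⟨le_min (le_min hρ0 hc0) hS0, (min_le_left _ _).trans (min_le_left _ _)⟩
  -- The three terms are the cap on the ratio, the bound from `gLow` at the prescribed end value,
  -- and the bounds from `gUp` along the least candidate.
  refine ⟨min (min M.rho c) (sInf S), ⟨?_, fun r' p' h => ?_⟩, ?_⟩
  · have hup := (hle _ (hrmem.2.trans hρ1)).1 (min_le_right _ _)
    rw [pRight_xmax]
    refine leftFeasible_max hlu hrmem lTilde_le_pBar (pBar_le_u (hlu _)) ?_
      ((le_max_right _ _).trans (hup _ ⟨hX, le_rfl⟩)) fun x hx => (le_max_left _ _).trans (hup x hx)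
    exact (M.le_CPu_iff hb0 hE).1 ((min_le_left _ _).trans (min_le_right _ _))
  · rw [pRight_xmax] at h
    obtain ⟨hr', -, hg, hval, hv⟩ := id h
    refine le_min (le_min hr'.2 ?_) ((hle _ (hr'.2.trans hρ1)).2 fun x hx => ?_)
    · rw [hc, M.le_CPu_iff hb0 hE, ← hv]
      exact (hg _ ⟨hX, le_rfl⟩).1
    · refine (max_le (h.lTilde_le hnonneg hmm hx) ?_).trans (hg x hx).2
      rw [← hv]
      exact (hval.2 x hx _ ⟨hX, le_rfl⟩ hx.2).1
  -- The right value is already at most `ρ` and `c`, so only `sInf S` survives in the minimum.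
  · have h := (pRight_isOptimal hX (hlu _)).1
    have h1 : M.rRight R C ≤ min M.rho c := by
      refine le_min h.1.2 ((M.le_CPu_iff hb0 hE).2 ?_)
      rw [← pRight_xmax (M := M) (R := R) (C := C)]
      exact (h.2.2.1 _ ⟨le_rfl, hXE⟩).1
    unfold Market.rStar
    rw [← min_assoc, min_eq_left h1]

end

end RobustAlloc

theorem theorem1 (M : Market) (R : Set (ℝ × ℝ)) (hconv : Convex ℝ R) (hne : R.Nonempty)
    (hnonneg : ∀ z ∈ R, 0 ≤ z.1 ∧ 0 ≤ z.2) (hbdd : BddAbove (proj R))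
    (C : ℝ) (hC0 : 0 ≤ C) (hC : C ≤ M.Cstar R) :
    -- the explicit functions solve the right and the left problem
    (∃ rLeft : ℝ,
      IsOptimal (M.RightFeasible R C) (M.rRight R C) (M.pRight R C) ∧
      IsOptimal (M.LeftFeasible R C (M.pRight R C (xmax R))) rLeft (M.pLeft R C) ∧
      M.rStar R C = min (M.rRight R C) rLeft) ∧
    -- gluing optimal solutions of the right and the left problem
    ∀ (rRight rLeft : ℝ) (pRight pLeft : ℝ → ℝ),
      IsOptimal (M.RightFeasible R C) rRight pRight →
      IsOptimal (M.LeftFeasible R C (pRight (xmax R))) rLeft pLeft →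
      -- the glued function is optimal for the transformed problem, with the stated value
      IsOptimal (M.TransFeasible R C) (min rRight rLeft) (M.glue R pLeft pRight) ∧
      -- its protection level algorithm is optimal among all online algorithms
      C ≤ (M.pla (M.glue R pLeft pRight)).toOnline.consis R ∧
      (M.pla (M.glue R pLeft pRight)).toOnline.robust = min rRight rLeft ∧
      ∀ A : OnlineAlg M, C ≤ A.consis R →
        A.robust ≤ (M.pla (M.glue R pLeft pRight)).toOnline.robust := by
  have hlu := M.lTilde_le_u_of_le_Cstar hne hnonneg hC
  have hC1 := M.le_one_of_le_Cstar hne hnonneg hC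
  have hX : 0 ≤ xmax R := (xmin_nonneg hnonneg).trans (xmin_le_xmax hne hnonneg hbdd)
  constructor
  · obtain ⟨rLeft, h1, h2⟩ := exists_pLeft_isOptimal hne hnonneg hbdd hlu
    exact ⟨rLeft, pRight_isOptimal hX (hlu _), h1, h2⟩
  intro rRight rLeft pRight pLeft hpr hpl
  have hopt := glue_isOptimal hne hnonneg hbdd hlu hpr hpl
  have hr := hopt.1.1
  have hval := fun x y (hx : 0 ≤ x) (hxy : x ≤ y) =>
    glue_valid (M := M) hpl.1.2.2.2.1 hpr.1.2.2.2 hpl.1.2.2.2.2 hx hxy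
  have hb := fun x (hx : 0 ≤ x) => glue_bounds hpr.1 hpl.1 hx
  have hcons : C ≤ (M.pla (M.glue R pLeft pRight)).toOnline.consis R :=
    le_pla_consis hne hnonneg hC0 hC1 (fun x hx => (hb x hx).2.2)
      (fun x hx => (hb x hx).2.1.trans (M.gUp_le_m hr.1 hx)) hval
      fun x hx => hopt.1.2.1 x ⟨proj_nonneg hnonneg hx, le_csSup hbdd hx⟩
  have hupper : ∀ A : OnlineAlg M, C ≤ A.consis R → A.robust ≤ min rRight rLeft := fun A hA => by
    obtain ⟨p, hp⟩ := A.exists_transFeasible hne hnonneg hA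
    exact hopt.2 _ p hp
  -- The universal upper bound, applied to the protection level algorithm itself, gives one
  -- inequality.
  have hrob : (M.pla (M.glue R pLeft pRight)).toOnline.robust = min rRight rLeft :=
    le_antisymm (hupper _ hcons) (le_pla_robust (fun x hx => (hb x hx).2.2) hval hr.1
      (hr.2.trans M.rho_lt_one.le) fun x hx => ⟨(hb x hx).1, (hb x hx).2.1⟩)
  exact ⟨hopt, hcons, hrob, fun A hA => hrob ▸ hupper A hA⟩
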